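/- Let $(\Omega,\mathcal F,\mathbb P)$ be a probability space with a filtration $\mathbb F=(\mathcal F_t)_{t\ge 0}$ satisfying the usual conditions, let $\tau=(\tau_1,\dots,\tau_n)$ be a vector of random times (random variables with values in $\mathbb R_+$), and let $\mu$ be a non-atomic $\sigma$-finite measure on $\mathbb R_+$. Assume the density hypothesis: for every non-negative Borel function $h$ on $\mathbb R_+^n$ and every $t\ge 0$, almost surely $$\mathbb E[h(\tau)\mid\mathcal F_t]=\int_{\mathbb R_+^n}h(\mathbf u)\,a_t(\mathbf u)\,\mu^{\otimes n}(d\mathbf u),$$ where the conditional density $a_t(\omega,\mathbf x)\ge 0$ is taken in its regular version: $a_t$ is $\bigcap_{s>t}(\mathcal F_s\otimes\mathcal B(\mathbb R_+^n))$-measurable, $t\mapsto a_t(\omega,\mathbf x)$ is càdlàg for all $(\omega,\mathbf x)$, and $(a_t(\mathbf x))_{t\ge0}$ is a $(\mathbb P,\mathbb F)$-martingale for each $\mathbf x$. For $J\subset\{1,\dots,n\}$ and a non-negative measurable function $f$ on $\mathbb R_+^n$, let $f_J(\mathbf z)=\int f(\mathfrak c_J(\mathbf z,\mathbf y))\,\mu^{\otimes(n-\#J)}(d\mathbf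 y)$, where $\mathfrak c_J(\mathbf z,\mathbf y)$ is the vector whose coordinates in $J$ are given by $\mathbf z$ and whose other coordinates are given by $\mathbf y$. Let $a_{J,t}$ be the càdlàg version of $(a_t)_J$, that is, a family with the same regularity as $a$ (in dimension $\#J$) such that for each $t$, almost surely, $a_{J,t}=(a_t)_J$ $\mu^{\otimes \#J}$-almost everywhere. Let $\tau_J=(\tau_i)_{i\in J}$, and let $\mathbb F^{\sigma(\tau_J)}$ be the initial enlargement, $\mathcal F^{\sigma(\tau_J)}_t=\bigcap_{s>t}(\mathcal F_s\vee\sigma(\tau_J))$. Let $\varrho:\{1,\dots,k\}\to\{1,\dots,n\}$ be injective, $T\subset\{1,\dots,k\}$ and $J=\varrho(T)$. Let $t\ge 0$ and let $g\ge0$ be a $\bigcap_{s>t}(\mathcal F_s\otimes\mathcal B(\mathbb R_+^n))$-measurable function on $\Omega\times\mathbb R_+^n$. Write $g(\tau)$ for the random variable $\omega\mapsto g(\omega,\tau(\omega))$; conditional expectations of non-negative variables take values in $[0,\infty]$. (i) For every bounded $\mathbb F^{\sigma(\tau_{\varrho(T)})}$-stopping time $U$, almost surely on $\{U\ge t\}$,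 $$\mathbb E\big[g(\tau)\,\big|\,\mathcal F^{\sigma(\tau_{\varrho(T)})}_U\big]=\frac{(g\,a_U)_{\varrho(T)}(\tau_{\varrho(T)})}{a_{\varrho(T),U}(\tau_{\varrho(T)})}\,\mathbf 1_{\{a_{\varrho(T),U}(\tau_{\varrho(T)})>0\}}.$$ (ii) For every bounded predictable $\mathbb F^{\sigma(\tau_{\varrho(T)})}$-stopping time $U$, almost surely on $\{U>t\}$ (and almost surely on all of $\Omega$ if $t=0$), $$\mathbb E\big[g(\tau)\,\big|\,\mathcal F^{\sigma(\tau_{\varrho(T)})}_{U-}\big]=\frac{(g\,a_{U-})_{\varrho(T)}(\tau_{\varrho(T)})}{a_{\varrho(T),U-}(\tau_{\varrho(T)})}\,\mathbf 1_{\{a_{\varrho(T),U-}(\tau_{\varrho(T)})>0\}},$$ with the conventions $a_{0-}=a_0$, $a_{J,0-}=a_{J,0}$ and $\mathcal G_{0-}=\mathcal G_0$ at time $0$. In particular, if $g$ is a non-negative Borel function on $\mathbb R_+^n$ (or, more generally, if $t=0$), both formulas hold almost surely, without restriction on $U$. -/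

import Mathlib

open MeasureTheory ProbabilityTheory Filter Topology
open scoped NNReal ENNReal

namespace MultiTime

section Filtrations

variable {Ω : Type*} {m : MeasurableSpace Ω}

/-- The usual conditions: right-continuity, and every `P`-null set belongs to `𝔽 0`
(in particular the probability space is complete). -/
def UsualConditions (P : Measure Ω) (𝔽 : Filtration ℝ≥0 m) : Prop :=
  𝔽.IsRightContinuous ∧ ∀ s : Set Ω, P s = 0 → MeasurableSet[𝔽 0] s

/-- The initial enlargement of `𝔽` with the random vector `ξ`: at time `t` it is the intersection
over `s > t` of `𝔽 s ∨ σ(ξ)`. -/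
def initialEnlargement {ι : Type*} (𝔽 : Filtration ℝ≥0 m) (ξ : Ω → ι → ℝ≥0)
    (hξ : Measurable ξ) : Filtration ℝ≥0 m where
  seq t := ⨅ s > t, 𝔽 s ⊔ MeasurableSpace.comap ξ inferInstance
  mono' _ _ hst := le_iInf₂ fun r hr => iInf₂_le r (lt_of_le_of_lt hst hr)
  le' t := iInf₂_le_of_le (t + 1) (lt_add_of_pos_right t one_pos)
    (sup_le (𝔽.le _) hξ.comap_le)

/-- A finite predictable stopping time: a stopping time `U` which is announced almost surely by a
sequence of stopping times, i.e. `V 0 ≤ V 1 ≤ ⋯ → U` with `V j < U` on `{U > 0}`. -/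
def IsPredictableTime (P : Measure Ω) (𝔾 : Filtration ℝ≥0 m) (U : Ω → ℝ≥0) : Prop :=
  IsStoppingTime 𝔾 (fun ω => (U ω : WithTop ℝ≥0)) ∧
  ∃ V : ℕ → Ω → ℝ≥0,
    (∀ j, IsStoppingTime 𝔾 (fun ω => (V j ω : WithTop ℝ≥0))) ∧
    ∀ᵐ ω ∂P, Monotone (fun j => V j ω) ∧ (0 < U ω → ∀ j, V j ω < U ω) ∧
      Tendsto (fun j => V j ω) atTop (𝓝 (U ω))

/-- The σ-algebra `𝔾_{U-}`: it is generated by the random variables `K_U`, where `K` runs over the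
predictable processes. (The predictable σ-algebra contains `{0} × A` for `A ∈ 𝔾 0`, so that
`𝔾_{0-} = 𝔾_0`.) -/
@[reducible]
def strictPast (𝔾 : Filtration ℝ≥0 m) (U : Ω → ℝ≥0) : MeasurableSpace Ω :=
  MeasurableSpace.comap (fun ω => (U ω, ω)) 𝔾.predictable

/-- A function `f` of `(ω, x)` is `⋂_{s > t} (𝔽 s ⊗ 𝓑(ℝ₊^ι))`-measurable. -/
def RightMeasurable {ι β : Type*} [MeasurableSpace β] (𝔽 : Filtration ℝ≥0 m) (t : ℝ≥0)
    (f : Ω → (ι → ℝ≥0) → β) : Prop :=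
  ∀ s > t, Measurable[(𝔽 s).prod MeasurableSpace.pi] fun p : Ω × (ι → ℝ≥0) => f p.1 p.2

/-- A regular (Jacod) family `a_t(ω, x)`: for each `t` it is
`⋂_{s > t} (𝔽 s ⊗ 𝓑(ℝ₊^ι))`-measurable, it is everywhere càdlàg in `t`, and `a(x)` is a
`(P, 𝔽)`-martingale for each fixed `x`. -/
structure IsRegularFamily {ι : Type*} (P : Measure Ω) (𝔽 : Filtration ℝ≥0 m)
    (a : ℝ≥0 → Ω → (ι → ℝ≥0) → ℝ≥0) : Prop where
  measurable : ∀ t, RightMeasurable 𝔽 t (a t)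
  right_cont : ∀ ω x t, ContinuousWithinAt (fun s => a s ω x) (Set.Ici t) t
  left_lim : ∀ ω x t, ∃ l, Tendsto (fun s => a s ω x) (𝓝[<] t) (𝓝 l)
  martingale : ∀ x, Martingale (fun t ω => (a t ω x : ℝ)) 𝔽 P

/-- Density hypothesis: `a_t` is, for every `t`, a density of the conditional law of the random
vector `ξ` given `𝔽 t` with respect to the product measure `μ^{⊗ι}`. -/
def IsConditionalDensity {ι : Type*} [Fintype ι] (P : Measure Ω) (𝔽 : Filtration ℝ≥0 m)
    (μ : Measure ℝ≥0) (ξ : Ω → ι → ℝ≥0) (a : ℝ≥0 → Ω → (ι → ℝ≥0) → ℝ≥0) : Prop :=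
  ∀ h : (ι → ℝ≥0) → ℝ≥0∞, Measurable h → ∀ t : ℝ≥0,
    P⁻[fun ω => h (ξ ω) | 𝔽 t] =ᵐ[P]
      fun ω => ∫⁻ u, h u * (a t ω u : ℝ≥0∞) ∂(Measure.pi fun _ : ι => μ)

end Filtrations

section Marginals

variable {n : ℕ}

/-- `x_J`, the vector of the coordinates of `x` with index in `J`. -/
def sub {β : Type*} (J : Finset (Fin n)) (x : Fin n → β) : {i // i ∈ J} → β := fun i => x i

/-- `𝔠_J(z, y)`, the vector `x` with `x_J = z` and `x_{Jᶜ} = y`. -/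
def glue {β : Type*} (J : Finset (Fin n)) (z : {i // i ∈ J} → β) (y : {i // i ∉ J} → β) :
    Fin n → β :=
  fun i => if h : i ∈ J then z ⟨i, h⟩ else y ⟨i, h⟩

/-- `f_J(z) = ∫ f(𝔠_J(z, y)) μ^{⊗(n-#J)}(dy)`. -/
noncomputable def marginal (μ : Measure ℝ≥0) (J : Finset (Fin n))
    (f : (Fin n → ℝ≥0) → ℝ≥0∞) (z : {i // i ∈ J} → ℝ≥0) : ℝ≥0∞ :=
  ∫⁻ y, f (glue J z y) ∂(Measure.pi fun _ : {i // i ∉ J} => μ)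

/-- The càdlàg version `a_{J,t}` of `(a_t)_J`: a regular family which, for every `t`, almost surely
coincides with `(a_t)_J` outside a `μ^{⊗J}`-null set. -/
structure IsMarginalVersion {Ω : Type*} {m : MeasurableSpace Ω} (P : Measure Ω)
    (𝔽 : Filtration ℝ≥0 m) (μ : Measure ℝ≥0) (J : Finset (Fin n))
    (a : ℝ≥0 → Ω → (Fin n → ℝ≥0) → ℝ≥0)
    (aJ : ℝ≥0 → Ω → ({i // i ∈ J} → ℝ≥0) → ℝ≥0) : Prop where
  regular : IsRegularFamily P 𝔽 aJ
  ae_eq : ∀ t, ∀ᵐ ω ∂P, ∀ᵐ z ∂(Measure.pi fun _ : {i // i ∈ J} => μ),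
    (aJ t ω z : ℝ≥0∞) = marginal μ J (fun x => (a t ω x : ℝ≥0∞)) z

/-- The ratio `(g b)_J(z) / b_J(z)` on `{b_J(z) > 0}`, and `0` elsewhere. -/
noncomputable def ratio (μ : Measure ℝ≥0) (J : Finset (Fin n)) (g : (Fin n → ℝ≥0) → ℝ≥0∞)
    (b : (Fin n → ℝ≥0) → ℝ≥0) (bJ : ({i // i ∈ J} → ℝ≥0) → ℝ≥0)
    (z : {i // i ∈ J} → ℝ≥0) : ℝ≥0∞ :=
  if 0 < bJ z then marginal μ J (fun x => g x * (b x : ℝ≥0∞)) z / (bJ z : ℝ≥0∞) else 0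

/-- `a_{t-}(ω, x)`, the left limit of `a(ω, x)` at `t`, with `a_{0-} = a_0`. -/
noncomputable def leftVal {Ω X : Type*} (a : ℝ≥0 → Ω → X → ℝ≥0) (t : ℝ≥0) (ω : Ω) (x : X) : ℝ≥0 :=
  Function.leftLim (fun s => a s ω x) t

theorem measurable_sub {Ω : Type*} [MeasurableSpace Ω] (J : Finset (Fin n))
    {τ : Ω → Fin n → ℝ≥0} (hτ : Measurable τ) : Measurable fun ω => sub J (τ ω) :=
  measurable_pi_lambda _ fun i => (measurable_pi_apply (i : Fin n)).comp hτ

end Marginals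

end MultiTime

/-! The proof replaces the enlarged filtration on `Ω` by a product filtration on `Ω × Z`, where `Z`
is the space of values of `τ_J`. The enlargement is the pullback of the right-continuous version of
`𝔽 t ⊗ 𝓑(Z)` under the graph map `ω ↦ (ω, τ_J ω)` (`initialEnlargement_eq_comap`). Hence a bounded
stopping time `U` is `S(ω, τ_J ω)` for a stopping time `S` on the product, and events prior to `U`
lift as well. For each frozen `z`, the section `S(·, z)` is an ordinary `𝔽`-stopping time.

Let `T` be a constant time beyond `U`. On `𝔽 T ⊗ 𝓑` the law of `(ω, τ ω)` has density `a_T` with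
respect to the product of `P` and the power of `μ` (`IsConditionalDensity.lintegral_eq`). An
expectation over an event prior to `U` is thus an integral against `a_T`. By Tonelli one freezes the
spatial variables and applies optional sampling to the martingale `a(x)` at `S(·, z)`, which turns
`a_T` into `a_S`; the same works for `a_J`. Dividing one integral by the other is Bayes' formula
(`lintegral_indicator_bayes`). No identity between `a_{J,S}` and the marginal of `a_S` is needed:
only integrals are compared, and on `{a_{J,S} = 0}` they show that `a_S` vanishes almost everywhere.

For `U-` the announcing sequence is lifted too. The strict past lies in the supremum of the pasts of
the announcing times, and optional sampling for left limits is Lévy's upward theorem along that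
sequence (`IsCadlagMartingale.lintegral_mul_leftVal`). -/

namespace MultiTime

/-! ### Stopping times and predictable σ-algebras under pullback -/

section Pullback

variable {X X' : Type*} {mX : MeasurableSpace X} {mX' : MeasurableSpace X'}
  {Q : Filtration ℝ≥0 mX} {Q' : Filtration ℝ≥0 mX'} {φ : X → X'}

/-- Used for two kinds of maps `φ`: the graph map `ω ↦ (ω, τ_J ω)` and the sections `ω ↦ (ω, z)`. -/
theorem isStoppingTime_comp (hφ : ∀ t, Measurable[Q t, Q' t] φ) {S : X' → WithTop ℝ≥0}
    (hS : IsStoppingTime Q' S) : IsStoppingTime Q (fun x => S (φ x)) :=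
  fun i => hφ i (hS i)

theorem measurable_stoppingTime_comp (hφ : ∀ t, Measurable[Q t, Q' t] φ) {S : X' → WithTop ℝ≥0}
    (hS : IsStoppingTime Q' S) :
    Measurable[(isStoppingTime_comp hφ hS).measurableSpace, hS.measurableSpace] φ := by
  intro A hA
  refine ⟨?_, fun i => hφ i (hA.2 i)⟩
  have : Measurable[⨆ t, Q t, ⨆ t, Q' t] φ := by
    rw [measurable_iff_comap_le, MeasurableSpace.comap_iSup]
    exact iSup_mono fun t => (hφ t).comap_le
  exact this hA.1

theorem measurable_predictable_map (hφ : ∀ t, Measurable[Q t, Q' t] φ) :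
    Measurable[Q.predictable, Q'.predictable] (fun p : ℝ≥0 × X => (p.1, φ p.2)) := by
  rw [measurable_iff_comap_le, MeasurableSpace.comap_le_iff_le_map]
  refine measurableSpace_le_predictable_of_measurableSet ?_ ?_
  · intro A hA
    exact measurableSet_predictable_singleton_bot_prod (hφ _ hA)
  · intro i A hA
    exact measurableSet_predictable_Ioi_prod (hφ _ hA)

theorem predictable_le_comap (hQ : ∀ t, Q t = (Q' t).comap φ) :
    Q.predictable ≤ Q'.predictable.comap (fun p : ℝ≥0 × X => (p.1, φ p.2)) := by
  refine measurableSpace_le_predictable_of_measurableSet ?_ ?_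
  · intro A hA
    rw [hQ] at hA
    obtain ⟨B, hB, rfl⟩ := hA
    exact ⟨_, measurableSet_predictable_singleton_bot_prod hB, rfl⟩
  · intro i A hA
    rw [hQ] at hA
    obtain ⟨B, hB, rfl⟩ := hA
    exact ⟨_, measurableSet_predictable_Ioi_prod hB, rfl⟩

theorem strictPast_le_comap (hQ : ∀ t, Q t = (Q' t).comap φ) (S : X' → ℝ≥0) :
    strictPast Q (fun x => S (φ x)) ≤ (strictPast Q' S).comap φ := by
  rintro _ ⟨W, hW, rfl⟩
  obtain ⟨W', hW', rfl⟩ := predictable_le_comap hQ _ hW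
  exact ⟨_, ⟨W', hW', rfl⟩, rfl⟩

/-- A bounded stopping time of a pulled back filtration is the pullback of a stopping time. -/
theorem exists_stoppingTime_lift (hQ : ∀ t, Q t = (Q' t).comap φ) [Q'.IsRightContinuous]
    {U : X → ℝ≥0} (hU : IsStoppingTime Q (fun x => (U x : WithTop ℝ≥0))) {C : ℝ≥0}
    (hC : ∀ x, U x ≤ C) :
    ∃ S : X' → ℝ≥0, IsStoppingTime Q' (fun x => (S x : WithTop ℝ≥0)) ∧ (∀ x, S x ≤ C) ∧
      ∀ x, S (φ x) = U x := by
  classical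
  have hD : ∀ q : ℚ≥0, ∃ D, MeasurableSet[Q' (q : ℝ≥0)] D ∧ φ ⁻¹' D = {x | U x ≤ (q : ℝ≥0)} := by
    intro q
    have := hU (q : ℝ≥0)
    rw [hQ] at this
    obtain ⟨D, hD, h⟩ := this
    exact ⟨D, hD, h.trans (by ext x; simp only [Set.mem_ofPred_eq, WithTop.coe_le_coe])⟩
  choose D hDm hD using hD
  -- The sets `D q` are chosen independently and need not increase with `q`. The infimum over those
  -- `q` with `x ∈ D q` still makes each `{S < s}` a countable union, which right-continuity
  -- accepts; capping at `C` keeps the bound off the image of `φ`.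
  let f : ℚ≥0 → X' → ℝ≥0 := fun q x => if x ∈ D q then min (q : ℝ≥0) C else C
  refine ⟨fun x => ⨅ q, f q x, ?_, ?_, ?_⟩
  · refine isStoppingTime_of_measurableSet_lt_of_isRightContinuous fun s => ?_
    have : {x | ((⨅ q, f q x : ℝ≥0) : WithTop ℝ≥0) < s} = ⋃ q, {x | f q x < s} := by
      ext x
      simp only [Set.mem_ofPred_eq, WithTop.coe_lt_coe, Set.mem_iUnion,
        ciInf_lt_iff (OrderBot.bddBelow (Set.range fun q => f q x))]
    rw [this]
    refine MeasurableSet.iUnion fun q => ?_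
    by_cases hs : C < s
    · have : {x | f q x < s} = Set.univ := by
        ext x
        simp only [f, Set.mem_ofPred_eq, Set.mem_univ, iff_true]
        split_ifs
        · exact (min_le_right _ _).trans_lt hs
        · exact hs
      rw [this]; exact @MeasurableSet.univ _ (Q' s)
    · by_cases hq : (q : ℝ≥0) < s
      · have : {x | f q x < s} = D q := by
          ext x
          simp only [f, Set.mem_ofPred_eq]
          split_ifs with h
          · simp [h, hq]
          · simp [h, hs]
        rw [this]; exact Q'.mono hq.le _ (hDm q)
      · have : {x | f q x < s} = ∅ := by
          ext x
          simp only [f, Set.mem_ofPred_eq, Set.mem_empty_iff_false, iff_false]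
          split_ifs with h
          · simpa [hq] using not_lt.1 hs
          · exact hs
        rw [this]; exact @MeasurableSet.empty _ (Q' s)
  · intro x
    refine (ciInf_le (OrderBot.bddBelow _) 0).trans ?_
    simp only [f]
    split_ifs
    · exact min_le_right _ _
    · exact le_rfl
  · intro x
    have hmem : ∀ q, φ x ∈ D q ↔ U x ≤ (q : ℝ≥0) := fun q => by
      have := Set.ext_iff.1 (hD q) x
      simpa using this
    apply le_antisymm
    · refine le_of_forall_gt fun c hc => ?_
      obtain ⟨q, hq0, hq1⟩ : ∃ q : ℚ≥0, U x < (q : ℝ≥0) ∧ (q : ℝ≥0) < c := by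
        obtain ⟨r, h0, h1⟩ := NNReal.lt_iff_exists_rat_btwn _ _ |>.1 hc
        refine ⟨⟨r, h0⟩, ?_, ?_⟩
        · have := h1.1
          rw [Real.toNNReal_of_nonneg (by exact_mod_cast h0)] at this
          exact this
        · have := h1.2
          rw [Real.toNNReal_of_nonneg (by exact_mod_cast h0)] at this
          exact this
      refine (ciInf_le (OrderBot.bddBelow _) q).trans_lt ?_
      simp only [f, hmem, hq0.le, if_true]
      exact (min_le_left _ _).trans_lt hq1
    · refine le_ciInf fun q => ?_
      simp only [f, hmem]
      split_ifs with h
      · exact le_min h (hC x)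
      · exact hC x

/-- The events prior to a lifted stopping time lift. -/
theorem measurableSpace_le_comap (hQ : ∀ t, Q t = (Q' t).comap φ) [Q'.IsRightContinuous]
    {U : X → ℝ≥0} (hU : IsStoppingTime Q (fun x => (U x : WithTop ℝ≥0))) {C : ℝ≥0}
    (hC : ∀ x, U x ≤ C) {S : X' → ℝ≥0} (hS : IsStoppingTime Q' (fun x => (S x : WithTop ℝ≥0)))
    (hSU : ∀ x, S (φ x) = U x) :
    hU.measurableSpace ≤ hS.measurableSpace.comap φ := by
  classical
  intro A hA
  -- The restriction of `U` to `A`, with `C + 1` standing for infinity. If `S'` lifts it, then `{S'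
  -- ≤ S}` lifts `A`.
  let V : X → ℝ≥0 := fun x => if x ∈ A then U x else C + 1
  have hV : IsStoppingTime Q (fun x => (V x : WithTop ℝ≥0)) := by
    intro s
    by_cases hs : C + 1 ≤ s
    · have : {x | (V x : WithTop ℝ≥0) ≤ s} = Set.univ := by
        ext x
        simp only [V, WithTop.coe_le_coe, Set.mem_ofPred_eq, Set.mem_univ, iff_true]
        split_ifs
        · exact (hC _).trans (le_self_add.trans hs)
        · exact hs
      rw [this]; exact @MeasurableSet.univ _ (Q s)
    · convert hA.2 s using 1
      ext x
      by_cases hx : x ∈ A <;>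
        simp only [V, hx, hs, WithTop.coe_le_coe, Set.mem_ofPred_eq, Set.mem_inter_iff, if_true,
          if_false, true_and, false_and]
  obtain ⟨S', hS', -, hSV⟩ := exists_stoppingTime_lift hQ hV (C := C + 1) (by
    intro x
    simp only [V]
    split_ifs
    · exact (hC _).trans le_self_add
    · exact le_rfl)
  refine ⟨{x | (S' x : WithTop ℝ≥0) ≤ S x}, hS'.measurableSet_stopping_time_le hS, ?_⟩
  ext x
  simp only [Set.mem_preimage, Set.mem_ofPred_eq, WithTop.coe_le_coe, hSV, hSU, V]
  by_cases hx : x ∈ A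
  · simp [hx]
  · simp only [hx, if_false, iff_false, not_le]
    exact (hC x).trans_lt (lt_add_of_pos_right _ one_pos)

end Pullback

/-! ### Measurability with respect to the past of a stopping time -/

section StoppedMeasurability

variable {X : Type*} {mX : MeasurableSpace X} {Q : Filtration ℝ≥0 mX}

theorem measurable_of_indicator_le {S : X → ℝ≥0}
    (hS : IsStoppingTime Q (fun x => (S x : WithTop ℝ≥0))) {β : Type*} [MeasurableSpace β] [Zero β]
    {f : X → β}
    (hf : ∀ s, Measurable[Q s] ({x | S x ≤ s}.indicator f)) : Measurable[hS.measurableSpace] f := by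
  intro B hB
  have key : ∀ i : ℝ≥0, MeasurableSet[Q i] (f ⁻¹' B ∩ {x | S x ≤ i}) := by
    intro i
    have h1 := hf i hB
    have h2 : MeasurableSet[Q i] {x | S x ≤ i} := by
      convert hS i using 1
      ext; simp only [Set.mem_ofPred_eq, WithTop.coe_le_coe]
    convert h1.inter h2 using 1
    ext x
    simp only [Set.mem_inter_iff, Set.mem_preimage, Set.mem_ofPred_eq]
    refine and_congr_left fun hx => ?_
    rw [Set.indicator_of_mem (show x ∈ {x | S x ≤ i} from hx)]
  refine ⟨?_, fun i => by simpa only [WithTop.coe_le_coe] using key i⟩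
  have : f ⁻¹' B = ⋃ n : ℕ, f ⁻¹' B ∩ {x | S x ≤ (n : ℝ≥0)} := by
    ext x
    simp only [Set.mem_iUnion, Set.mem_inter_iff, Set.mem_ofPred_eq]
    exact ⟨fun h => (exists_nat_ge (S x)).imp fun n hn => ⟨h, hn⟩, fun ⟨_, h, _⟩ => h⟩
  rw [this]
  exact MeasurableSet.iUnion fun n => le_iSup (fun t => Q t) (n : ℝ≥0) _ (key n)

theorem rightCont_le_of_lt (Q : Filtration ℝ≥0 mX) {s r : ℝ≥0} (h : s < r) :
    Q.rightCont s ≤ Q r := by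
  rw [Filtration.rightCont_eq]
  exact iInf₂_le r h

theorem measurable_rightCont_iff {β : Type*} [MeasurableSpace β] {f : X → β} {s : ℝ≥0} :
    Measurable[Q.rightCont s] f ↔ ∀ r > s, Measurable[Q r] f := by
  refine ⟨fun h r hr => h.mono (rightCont_le_of_lt Q hr) le_rfl, fun h B hB => ?_⟩
  rw [Filtration.rightCont_eq]
  simp only [MeasurableSpace.measurableSet_iInf]
  exact fun r hr => h r hr hB

theorem measurableSpace_le_of_bounded {S : X → ℝ≥0}
    (hS : IsStoppingTime Q (fun x => (S x : WithTop ℝ≥0))) {C : ℝ≥0} (hC : ∀ x, S x ≤ C) :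
    hS.measurableSpace ≤ Q C :=
  hS.measurableSpace_le_of_le_const fun x => by exact_mod_cast hC x

/-- Announcing a time from below: the strict past is generated by the pasts of the
approximating times. -/
theorem strictPast_le_iSup {V : ℕ → X → ℝ≥0}
    (hV : ∀ j, IsStoppingTime Q (fun x => (V j x : WithTop ℝ≥0)))
    {S : X → ℝ≥0} (hS : ∀ x, IsLUB (Set.range fun j => V j x) (S x)) :
    strictPast Q S ≤ ⨆ j, (hV j).measurableSpace := by
  rw [strictPast, MeasurableSpace.comap_le_iff_le_map]
  refine measurableSpace_le_predictable_of_measurableSet ?_ ?_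
  · intro A hA
    have : (fun x => (S x, x)) ⁻¹' ({⊥} ×ˢ A) = ⋂ j, A ∩ {x | (V j x : WithTop ℝ≥0) ≤ (0 : ℝ≥0)} := by
      ext x
      have : S x = 0 ↔ ∀ j, V j x ≤ 0 := by
        rw [← nonpos_iff_eq_zero, isLUB_le_iff (hS x)]
        simp [mem_upperBounds]
      simp only [Set.mem_preimage, Set.mem_prod, Set.mem_singleton_iff, NNReal.bot_eq_zero, this,
        Set.mem_iInter, Set.mem_inter_iff, Set.mem_ofPred_eq, WithTop.coe_le_coe]
      exact ⟨fun h j => ⟨h.2, h.1 j⟩, fun h => ⟨fun j => (h j).2, (h 0).1⟩⟩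
    rw [MeasurableSpace.map_def, this]
    refine MeasurableSet.iInter fun j => le_iSup (fun j => (hV j).measurableSpace) j _ ?_
    have h0 : MeasurableSet[Q 0] (A ∩ {x | (V j x : WithTop ℝ≥0) ≤ (0 : ℝ≥0)}) :=
      MeasurableSet.inter hA (hV j 0)
    refine ⟨le_iSup (fun t => Q t) 0 _ h0, fun i => ?_⟩
    exact (Q.mono (zero_le) _ h0).inter (hV j i)
  · intro s A hA
    have : (fun x => (S x, x)) ⁻¹' (Set.Ioi s ×ˢ A) = ⋃ j, A ∩ {x | (V j x : WithTop ℝ≥0) ≤ s}ᶜ := by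
      ext x
      have : s < S x ↔ ∃ j, s < V j x := by
        rw [lt_isLUB_iff (hS x)]
        simp
      simp only [Set.mem_preimage, Set.mem_prod, Set.mem_Ioi, this, Set.mem_iUnion, Set.mem_inter_iff,
        Set.mem_compl_iff, Set.mem_ofPred_eq, WithTop.coe_le_coe, not_le]
      exact ⟨fun h => h.1.imp fun j hj => ⟨h.2, hj⟩, fun ⟨j, h, hj⟩ => ⟨⟨j, hj⟩, h⟩⟩
    rw [MeasurableSpace.map_def, this]
    refine MeasurableSet.iUnion fun j => le_iSup (fun j => (hV j).measurableSpace) j _ ?_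
    refine ⟨le_iSup (fun t => Q t) s _ (hA.inter (hV j s).compl), fun i => ?_⟩
    rcases le_total s i with h | h
    · exact (Q.mono h _ (hA.inter (hV j s).compl)).inter (hV j i)
    · have : A ∩ {x | (V j x : WithTop ℝ≥0) ≤ s}ᶜ ∩ {x | (V j x : WithTop ℝ≥0) ≤ i} = ∅ := by
        ext x
        simp only [Set.mem_inter_iff, Set.mem_compl_iff, Set.mem_ofPred_eq, WithTop.coe_le_coe,
          Set.mem_empty_iff_false, iff_false, not_and, not_le]
        exact fun h' => h.trans_lt h'.2
      rw [this]; exact @MeasurableSet.empty _ (Q i)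

end StoppedMeasurability

/-! ### The initial enlargement as a pullback from the product space -/

section Enlargement

variable {Ω Z : Type*} {m : MeasurableSpace Ω} [mZ : MeasurableSpace Z]

/-- The filtration `𝔽 t ⊗ 𝓑(Z)` on `Ω × Z`. -/
def prodFiltration (𝔽 : Filtration ℝ≥0 m) (Z : Type*) [mZ : MeasurableSpace Z] :
    Filtration ℝ≥0 (m.prod mZ) where
  seq t := (𝔽 t).prod mZ
  mono' _ _ h := sup_le_sup (MeasurableSpace.comap_mono (𝔽.mono h)) le_rfl
  le' t := sup_le_sup (MeasurableSpace.comap_mono (𝔽.le t)) le_rfl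

/-- Makes `S(·, z)` an `𝔽`-stopping time. Right-continuity of `𝔽` absorbs the intersection over
later times. -/
theorem measurable_section (𝔽 : Filtration ℝ≥0 m) [𝔽.IsRightContinuous] (z : Z) (t : ℝ≥0) :
    Measurable[𝔽 t, (prodFiltration 𝔽 Z).rightCont t] (fun ω => (ω, z)) := by
  have h : ∀ r > t, Measurable[𝔽 r, (prodFiltration 𝔽 Z).rightCont t] (fun ω => (ω, z)) :=
    fun r hr => Measurable.mono (measurable_prodMk_right (m := 𝔽 r) (y := z)) le_rfl
      (rightCont_le_of_lt (prodFiltration 𝔽 Z) hr)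
  intro A hA
  refine Filtration.IsRightContinuous.measurableSet ?_
  rw [Filtration.rightCont_eq]
  simp only [MeasurableSpace.measurableSet_iInf]
  exact fun r hr => h r hr hA

theorem initialEnlargement_eq_comap {ι : Type*} (𝔽 : Filtration ℝ≥0 m) (ξ : Ω → ι → ℝ≥0)
    (hξ : Measurable ξ) (t : ℝ≥0) :
    initialEnlargement 𝔽 ξ hξ t =
      ((prodFiltration 𝔽 (ι → ℝ≥0)).rightCont t).comap (fun ω => (ω, ξ ω)) := by
  have hsup : ∀ s, 𝔽 s ⊔ MeasurableSpace.comap ξ inferInstance =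
      (prodFiltration 𝔽 (ι → ℝ≥0) s).comap (fun ω => (ω, ξ ω)) := by
    intro s
    change _ = MeasurableSpace.comap _ (_ ⊔ _)
    rw [MeasurableSpace.comap_sup, MeasurableSpace.comap_comp, MeasurableSpace.comap_comp]
    congr 1
    exact MeasurableSpace.comap_id.symm
  change (⨅ s > t, 𝔽 s ⊔ MeasurableSpace.comap ξ inferInstance) = _
  simp only [hsup]
  apply le_antisymm
  · intro A hA
    simp only [MeasurableSpace.measurableSet_iInf] at hA
    have h1 : ∀ n : ℕ, t < t + 1 / ((n : ℝ≥0) + 1) := fun n =>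
      lt_add_of_pos_right _ (by positivity)
    choose D hD hDA using fun n : ℕ => hA _ (h1 n)
    -- A set in every later σ-algebra comes with a different lift `D n` at each time. Their limsup
    -- has the same preimage, and since it depends only on the tail it belongs to every `r > t`.
    refine ⟨limsup D atTop, ?_, ?_⟩
    · rw [Filtration.rightCont_eq]
      simp only [MeasurableSpace.measurableSet_iInf]
      intro r hr
      obtain ⟨N, hN⟩ : ∃ N : ℕ, t + 1 / ((N : ℝ≥0) + 1) < r := by
        obtain ⟨N, hN⟩ := exists_nat_one_div_lt (tsub_pos_of_lt hr)
        exact ⟨N, lt_tsub_iff_left.1 hN⟩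
      rw [← Filter.limsup_nat_add D N]
      refine @MeasurableSet.measurableSet_limsup _ (prodFiltration 𝔽 (ι → ℝ≥0) r) _ fun n => ?_
      refine (prodFiltration 𝔽 (ι → ℝ≥0)).mono ?_ _ (hD (n + N))
      refine le_trans ?_ hN.le
      gcongr
      exact_mod_cast Nat.le_add_left N n
    · ext ω
      have : ∀ n, (ω, ξ ω) ∈ D n ↔ ω ∈ A := fun n => by
        have := Set.ext_iff.1 (hDA n) ω
        simpa using this
      simp [Filter.mem_limsup_iff_frequently_mem, this]
  · refine le_iInf₂ fun s hs => MeasurableSpace.comap_mono (rightCont_le_of_lt _ hs)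

end Enlargement

/-! ### Approximation of times from the right -/

section Discretization

/-- The least multiple of `1 / (n + 1)` which is larger than `v`. -/
noncomputable def upperDiscretization (n : ℕ) (v : ℝ≥0) : ℝ≥0 :=
  ((⌊((n : ℝ≥0) + 1) * v⌋₊ : ℝ≥0) + 1) / ((n : ℝ≥0) + 1)

theorem lt_upperDiscretization (n : ℕ) (v : ℝ≥0) : v < upperDiscretization n v := by
  rw [upperDiscretization, lt_div_iff₀ (by positivity), mul_comm]
  exact Nat.lt_floor_add_one _

theorem upperDiscretization_le (n : ℕ) (v : ℝ≥0) :
    upperDiscretization n v ≤ v + 1 / ((n : ℝ≥0) + 1) := by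
  rw [upperDiscretization, add_div]
  gcongr
  rw [div_le_iff₀ (by positivity), mul_comm]
  exact Nat.floor_le (by positivity)

theorem tendsto_upperDiscretization (v : ℝ≥0) :
    Tendsto (fun n => upperDiscretization n v) atTop (𝓝[≥] v) := by
  refine tendsto_nhdsWithin_iff.2 ⟨?_, .of_forall fun n => (lt_upperDiscretization n v).le⟩
  refine tendsto_of_tendsto_of_tendsto_of_le_of_le tendsto_const_nhds ?_
    (fun n => (lt_upperDiscretization n v).le) (fun n => upperDiscretization_le n v)
  have : Tendsto (fun n : ℕ => v + 1 / ((n : ℝ≥0) + 1)) atTop (𝓝 (v + 0)) :=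
    tendsto_const_nhds.add tendsto_one_div_add_atTop_nhds_zero_nat
  simpa using this

theorem upperDiscretization_le_iff (n : ℕ) (v i : ℝ≥0) :
    upperDiscretization n v ≤ i ↔ v < (⌊((n : ℝ≥0) + 1) * i⌋₊ : ℝ≥0) / ((n : ℝ≥0) + 1) := by
  rw [upperDiscretization, div_le_iff₀ (by positivity), lt_div_iff₀ (by positivity), mul_comm i,
    mul_comm v, ← Nat.cast_add_one, ← Nat.le_floor_iff (by positivity), Nat.succ_le_iff,
    Nat.floor_lt (by positivity)]

theorem countable_range_upperDiscretization {X : Type*} (n : ℕ) (S : X → ℝ≥0) :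
    (Set.range fun x => (upperDiscretization n (S x) : WithTop ℝ≥0)).Countable := by
  refine (Set.countable_range fun k : ℕ =>
    ((((k : ℝ≥0) + 1) / ((n : ℝ≥0) + 1) : ℝ≥0) : WithTop ℝ≥0)).mono ?_
  rintro _ ⟨x, rfl⟩
  exact ⟨_, rfl⟩

theorem isStoppingTime_upperDiscretization {X : Type*} {mX : MeasurableSpace X}
    {Q : Filtration ℝ≥0 mX} {S : X → ℝ≥0} (hS : IsStoppingTime Q fun x => (S x : WithTop ℝ≥0))
    (n : ℕ) : IsStoppingTime Q fun x => (upperDiscretization n (S x) : WithTop ℝ≥0) := by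
  intro i
  have := hS.measurableSet_lt ((⌊((n : ℝ≥0) + 1) * i⌋₊ : ℝ≥0) / ((n : ℝ≥0) + 1))
  simp only [WithTop.coe_le_coe, WithTop.coe_lt_coe, upperDiscretization_le_iff] at this ⊢
  refine Q.mono ?_ _ this
  rw [div_le_iff₀ (by positivity), mul_comm i]
  exact Nat.floor_le (by positivity)

theorem measurable_select {X β : Type*} [MeasurableSpace X] [MeasurableSpace β] {N : X → ℕ}
    (hN : Measurable N) {F : ℕ → X → β} (hF : ∀ k, Measurable (F k)) :
    Measurable fun x => F (N x) x := by
  have : Measurable fun p : ℕ × X => F p.1 p.2 := measurable_from_prod_countable_right hF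
  exact this.comp (hN.prodMk measurable_id)

/-- A right-continuous family is jointly measurable in time and space. -/
theorem measurable_min_const_of_rightContinuous {X β : Type*} [mX : MeasurableSpace X]
    [TopologicalSpace β] [TopologicalSpace.PseudoMetrizableSpace β] [MeasurableSpace β]
    [BorelSpace β] {f : ℝ≥0 → X → β} {s r : ℝ≥0} (hsr : s < r)
    (hf : ∀ t < r, Measurable (f t))
    (hrc : ∀ x t, ContinuousWithinAt (fun s => f s x) (Set.Ici t) t) :
    Measurable fun p : ℝ≥0 × X => f (min p.1 s) p.2 := by
  -- The discretized times overshoot `s`, while measurability is given only before `r`. Truncating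
  -- at `r'` stays in that range and does not disturb the limit.
  obtain ⟨r', hsr', hr'⟩ := exists_between hsr
  refine measurable_of_tendsto_metrizable
    (f := fun n (p : ℝ≥0 × X) => f (min (upperDiscretization n (min p.1 s)) r') p.2) ?_ ?_
  · intro n
    have h1 : Measurable fun p : ℝ≥0 × X => ⌊((n : ℝ≥0) + 1) * min p.1 s⌋₊ :=
      Nat.measurable_floor.comp (by fun_prop)
    exact measurable_select h1
      (F := fun k p => f (min (((k : ℝ≥0) + 1) / ((n : ℝ≥0) + 1)) r') p.2)
      fun k => (hf _ ((min_le_right _ _).trans_lt hr')).comp measurable_snd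
  · rw [tendsto_pi_nhds]
    intro p
    refine (hrc p.2 (min p.1 s)).tendsto.comp ?_
    have h := tendsto_upperDiscretization (min p.1 s)
    rw [tendsto_nhdsWithin_iff] at h ⊢
    refine ⟨?_, .of_forall fun n => ?_⟩
    · have := h.1.min (tendsto_const_nhds (x := r'))
      rwa [min_eq_left ((min_le_right _ _).trans hsr'.le)] at this
    · exact le_min (lt_upperDiscretization n _).le ((min_le_right _ _).trans hsr'.le)

theorem measurable_min_const_stoppingTime {X : Type*} {mX : MeasurableSpace X}
    {Q : Filtration ℝ≥0 mX} {S : X → ℝ≥0} (hS : IsStoppingTime Q fun x => (S x : WithTop ℝ≥0))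
    (s : ℝ≥0) : Measurable[Q s] fun x => min (S x) s := by
  refine measurable_of_Iic (mδ := Q s) fun i => ?_
  rcases le_total s i with h | h
  · have : (fun x => min (S x) s) ⁻¹' Set.Iic i = Set.univ := by
      ext x; simp [h]
    rw [this]; exact @MeasurableSet.univ _ (Q s)
  · have h1 := Q.mono h _ (hS i)
    rcases h.lt_or_eq with h2 | rfl
    · convert h1 using 1
      ext x
      simp only [Set.mem_preimage, Set.mem_Iic, min_le_iff, Set.mem_ofPred_eq, WithTop.coe_le_coe,
        not_le.2 h2, or_false]
    · have : (fun x => min (S x) i) ⁻¹' Set.Iic i = Set.univ := by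
        ext x; simp
      rw [this]; exact @MeasurableSet.univ _ (Q i)

/-- The value of a right-continuous adapted process at a stopping time `S` is measurable for the
events prior to `S`. -/
theorem measurable_stopped_of_rightContinuous {X β : Type*} {mX : MeasurableSpace X}
    [TopologicalSpace β] [TopologicalSpace.PseudoMetrizableSpace β] [MeasurableSpace β]
    [BorelSpace β] [Zero β]
    {Q : Filtration ℝ≥0 mX} [Q.IsRightContinuous] {f : ℝ≥0 → X → β}
    (hf : ∀ t, Measurable[Q t] (f t))
    (hrc : ∀ x t, ContinuousWithinAt (fun s => f s x) (Set.Ici t) t)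
    {S : X → ℝ≥0} (hS : IsStoppingTime Q fun x => (S x : WithTop ℝ≥0)) :
    Measurable[hS.measurableSpace] fun x => f (S x) x := by
  refine measurable_of_indicator_le hS fun s => ?_
  -- Joint measurability costs a little time beyond `s`; right-continuity of `Q` recovers it.
  have : Measurable[Q.rightCont s] ({x | S x ≤ s}.indicator fun x => f (S x) x) := by
    refine measurable_rightCont_iff.2 fun r hr => ?_
    have h1 := @measurable_min_const_of_rightContinuous X β (Q r) _ _ _ _ f s r hr
      (fun t ht => (hf t).mono (Q.mono ht.le) le_rfl) hrc
    have h2 : Measurable[Q r, NNReal.measurableSpace.prod (Q r)] fun x => (min (S x) s, x) :=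
      @Measurable.prodMk _ _ _ _ _ (Q r) _ _
        ((measurable_min_const_stoppingTime hS s).mono (Q.mono hr.le) le_rfl)
        (@measurable_id _ (Q r))
    have h3 : MeasurableSet[Q r] {x | S x ≤ s} := by
      convert Q.mono hr.le _ (hS s) using 1
      ext; simp only [Set.mem_ofPred_eq, WithTop.coe_le_coe]
    have h4 := (h1.comp h2).indicator h3
    convert h4 using 1
    ext x
    by_cases hx : S x ≤ s
    · simp [Set.indicator, hx]
    · simp [Set.indicator, hx]
  rwa [Filtration.IsRightContinuous.eq (𝓕 := Q)] at this

end Discretization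

/-! ### Optional sampling at stopping times and at announced left limits -/

section OptionalSampling

/-- The measures with densities `f₁` and `f₂` agree on `𝓗`, hence so do their integrals of `h`; no
integrability is required. -/
theorem lintegral_mul_of_forall_setLIntegral_eq {Ω : Type*} {m : MeasurableSpace Ω}
    {P : Measure Ω} {𝓗 : MeasurableSpace Ω} (h𝓗 : 𝓗 ≤ m)
    {f₁ f₂ h : Ω → ℝ≥0∞} (hf₁ : AEMeasurable f₁ P) (hf₂ : AEMeasurable f₂ P)
    (hf : ∀ A, MeasurableSet[𝓗] A → ∫⁻ ω in A, f₁ ω ∂P = ∫⁻ ω in A, f₂ ω ∂P)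
    (hh : Measurable[𝓗] h) : ∫⁻ ω, h ω * f₁ ω ∂P = ∫⁻ ω, h ω * f₂ ω ∂P := by
  have key : (P.withDensity f₁).trim h𝓗 = (P.withDensity f₂).trim h𝓗 := by
    refine @Measure.ext _ 𝓗 _ _ fun A hA => ?_
    rw [trim_measurableSet_eq h𝓗 hA, trim_measurableSet_eq h𝓗 hA,
      withDensity_apply _ (h𝓗 _ hA), withDensity_apply _ (h𝓗 _ hA), hf A hA]
  have h1 : ∀ f : Ω → ℝ≥0∞, AEMeasurable f P →
      ∫⁻ ω, h ω * f ω ∂P = ∫⁻ ω, h ω ∂((P.withDensity f).trim h𝓗) := by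
    intro f hf
    rw [lintegral_trim h𝓗 hh, lintegral_withDensity_eq_lintegral_mul₀ hf
      (hh.mono h𝓗 le_rfl).aemeasurable]
    simp [mul_comm]
  rw [h1 _ hf₁, h1 _ hf₂, key]

variable {Ω : Type*} {m : MeasurableSpace Ω} {P : Measure Ω} [IsProbabilityMeasure P]
  {𝔽 : Filtration ℝ≥0 m}

/-- Optional sampling for right-continuous martingales at bounded stopping times. -/
theorem stopped_ae_eq_condExp [𝔽.IsRightContinuous] {N : ℝ≥0 → Ω → ℝ} (hN : Martingale N 𝔽 P)
    (hrc : ∀ ω t, ContinuousWithinAt (fun s => N s ω) (Set.Ici t) t)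
    {S : Ω → ℝ≥0} (hS : IsStoppingTime 𝔽 fun x => (S x : WithTop ℝ≥0)) {C : ℝ≥0}
    (hC : ∀ ω, S ω ≤ C) :
    (fun ω => N (S ω) ω) =ᵐ[P] P[N (C + 1) | hS.measurableSpace] := by
  let S' : ℕ → Ω → ℝ≥0 := fun n ω => upperDiscretization n (S ω)
  have hS' : ∀ n, IsStoppingTime 𝔽 fun x => (S' n x : WithTop ℝ≥0) :=
    isStoppingTime_upperDiscretization hS
  have hS'C : ∀ n ω, (S' n ω : WithTop ℝ≥0) ≤ ((C + 1 : ℝ≥0) : WithTop ℝ≥0) := by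
    intro n ω
    rw [WithTop.coe_le_coe]
    refine (upperDiscretization_le n _).trans (add_le_add (hC ω) ?_)
    rw [div_le_one (by positivity)]
    simp
  have hae : ∀ n, (fun ω => N (S' n ω) ω) =ᵐ[P] P[N (C + 1) | (hS' n).measurableSpace] := fun n =>
    hN.stoppedValue_ae_eq_condExp_of_le_const_of_countable_range (hS' n) (hS'C n)
      (countable_range_upperDiscretization n S)
  have hint := hN.integrable (C + 1)
  -- Conditional expectations of a single integrable variable are uniformly integrable, so the
  -- pointwise limit is also an `L¹` limit.
  have hui : UniformIntegrable (fun n ω => N (S' n ω) ω) 1 P :=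
    (hint.uniformIntegrable_condExp fun n => (hS' n).measurableSpace_le).ae_eq
      fun n => (hae n).symm
  have hlim : ∀ᵐ ω ∂P, Tendsto (fun n => N (S' n ω) ω) atTop (𝓝 (N (S ω) ω)) :=
    .of_forall fun ω => (hrc ω (S ω)).tendsto.comp (tendsto_upperDiscretization (S ω))
  have hmem : MemLp (fun ω => N (S ω) ω) 1 P := hui.memLp_of_ae_tendsto hlim
  have hL1 := tendsto_Lp_finite_of_tendsto_ae le_rfl ENNReal.one_ne_top
    hui.1 hmem hui.2.1 hlim
  refine ae_eq_condExp_of_forall_setIntegral_eq hS.measurableSpace_le hint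
    (fun s _ _ => (memLp_one_iff_integrable.1 hmem).integrableOn) ?_ ?_
  · intro A hA _
    have h1 := tendsto_setIntegral_of_L1' _ hmem.1
      (.of_forall fun n => memLp_one_iff_integrable.1 (hui.memLp n)) hL1 A
    refine tendsto_nhds_unique h1 (tendsto_const_nhds.congr fun n => ?_)
    have hA' : MeasurableSet[(hS' n).measurableSpace] A := by
      refine IsStoppingTime.measurableSpace_mono hS (hS' n) (fun ω => ?_) A hA
      exact WithTop.coe_le_coe.2 (lt_upperDiscretization n (S ω)).le
    rw [setIntegral_congr_ae (hS.measurableSpace_le _ hA) ((hae n).mono fun ω h _ => h),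
      setIntegral_condExp (hS' n).measurableSpace_le hint hA']
  · refine StronglyMeasurable.aestronglyMeasurable ?_
    refine Measurable.stronglyMeasurable ?_
    exact measurable_stopped_of_rightContinuous
      (fun t => (hN.1 t).measurable) hrc hS

theorem lintegral_mul_condExp {𝓗 : MeasurableSpace Ω} (h𝓗 : 𝓗 ≤ m) {N : Ω → ℝ≥0}
    (hN : Integrable (fun ω => (N ω : ℝ)) P) {h : Ω → ℝ≥0∞} (hh : Measurable[𝓗] h) :
    ∫⁻ ω, h ω * (N ω : ℝ≥0∞) ∂P =
      ∫⁻ ω, h ω * ENNReal.ofReal ((P[fun ω => (N ω : ℝ) | 𝓗]) ω) ∂P := by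
  have h1 := condLExp_ofReal 𝓗 hN (.of_forall fun ω => (N ω).coe_nonneg)
  simp only [ENNReal.ofReal_coe_nnreal] at h1
  have h2 : (fun ω => h ω * ENNReal.ofReal ((P[fun ω => (N ω : ℝ) | 𝓗]) ω)) =ᵐ[P]
      fun ω => h ω * (P⁻[fun ω => (N ω : ℝ≥0∞) | 𝓗]) ω := h1.mono fun ω h => by simp [h]
  rw [lintegral_congr_ae h2]
  refine lintegral_mul_of_forall_setLIntegral_eq h𝓗 ?_ (measurable_condLExp' _ _ _).aemeasurable
    (fun A hA => (setLIntegral_condLExp h𝓗 _ _ hA).symm) hh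
  have := hN.1.aemeasurable.ennreal_ofReal
  simpa using this

/-- A nonnegative càdlàg martingale. -/
structure IsCadlagMartingale (P : Measure Ω) (𝔽 : Filtration ℝ≥0 m) (M : ℝ≥0 → Ω → ℝ≥0) :
    Prop where
  martingale : Martingale (fun t ω => (M t ω : ℝ)) 𝔽 P
  right_cont : ∀ ω t, ContinuousWithinAt (fun s => M s ω) (Set.Ici t) t
  left_lim : ∀ ω t, ∃ l, Tendsto (fun s => M s ω) (𝓝[<] t) (𝓝 l)

variable {M : ℝ≥0 → Ω → ℝ≥0}

theorem IsCadlagMartingale.stopped_ae_eq [𝔽.IsRightContinuous] (hM : IsCadlagMartingale P 𝔽 M)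
    {S : Ω → ℝ≥0} (hS : IsStoppingTime 𝔽 fun x => (S x : WithTop ℝ≥0)) {C : ℝ≥0}
    (hC : ∀ ω, S ω ≤ C) :
    (fun ω => (M (S ω) ω : ℝ)) =ᵐ[P] P[fun ω => (M (C + 1) ω : ℝ) | hS.measurableSpace] :=
  stopped_ae_eq_condExp hM.martingale
    (fun ω t => NNReal.continuous_coe.continuousAt.comp_continuousWithinAt (hM.right_cont ω t)) hS hC

theorem IsCadlagMartingale.lintegral_mul_stopped [𝔽.IsRightContinuous]
    (hM : IsCadlagMartingale P 𝔽 M)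
    {S : Ω → ℝ≥0} (hS : IsStoppingTime 𝔽 fun x => (S x : WithTop ℝ≥0)) {C : ℝ≥0}
    (hC : ∀ ω, S ω ≤ C) {h : Ω → ℝ≥0∞} (hh : Measurable[hS.measurableSpace] h) :
    ∫⁻ ω, h ω * (M (C + 1) ω : ℝ≥0∞) ∂P = ∫⁻ ω, h ω * (M (S ω) ω : ℝ≥0∞) ∂P := by
  rw [lintegral_mul_condExp hS.measurableSpace_le (hM.martingale.integrable _) hh]
  refine lintegral_congr_ae ((hM.stopped_ae_eq hS hC).mono fun ω h => ?_)
  simp only at h ⊢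
  rw [← h, ENNReal.ofReal_coe_nnreal]

theorem tendsto_leftVal {X : Type*} {a : ℝ≥0 → Ω → X → ℝ≥0} {ω : Ω} {x : X} {s : ℝ≥0}
    {v : ℕ → ℝ≥0} (hv : Tendsto v atTop (𝓝 s)) (hlt : ∀ j, v j < s)
    (hl : ∃ l, Tendsto (fun s => a s ω x) (𝓝[<] s) (𝓝 l)) :
    Tendsto (fun j => a (v j) ω x) atTop (𝓝 (leftVal a s ω x)) := by
  exact (tendsto_leftLim_of_tendsto hl).comp
    (tendsto_nhdsWithin_iff.2 ⟨hv, .of_forall hlt⟩)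

theorem leftVal_zero {X : Type*} {a : ℝ≥0 → Ω → X → ℝ≥0} {ω : Ω} {x : X} :
    leftVal a 0 ω x = a 0 ω x :=
  leftLim_eq_of_isBot fun _ => zero_le

/-- Optional sampling at the left limit at an announced time `S`. -/
theorem IsCadlagMartingale.lintegral_mul_leftVal [𝔽.IsRightContinuous] {X : Type*}
    {a : ℝ≥0 → Ω → X → ℝ≥0} {x : X} (hM : IsCadlagMartingale P 𝔽 fun s ω => a s ω x)
    {V : ℕ → Ω → ℝ≥0} (hV : ∀ j, IsStoppingTime 𝔽 fun x => (V j x : WithTop ℝ≥0))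
    (hmono : ∀ ω, Monotone fun j => V j ω) {C : ℝ≥0} (hC : ∀ j ω, V j ω ≤ C)
    {S : Ω → ℝ≥0} (hS : ∀ ω, Tendsto (fun j => V j ω) atTop (𝓝 (S ω)))
    {h : Ω → ℝ≥0∞} (hh : Measurable[⨆ j, (hV j).measurableSpace] h)
    (h0 : ∀ ω, h ω ≠ 0 → S ω = 0 ∨ ∀ j, V j ω < S ω) :
    ∫⁻ ω, h ω * (a (C + 1) ω x : ℝ≥0∞) ∂P = ∫⁻ ω, h ω * (leftVal a (S ω) ω x : ℝ≥0∞) ∂P := by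
  let 𝓖 : Filtration ℕ m :=
    { seq := fun j => (hV j).measurableSpace
      mono' := fun i j hij => IsStoppingTime.measurableSpace_mono _ _
        fun ω => WithTop.coe_le_coe.2 (hmono ω hij)
      le' := fun j => (hV j).measurableSpace_le }
  have hle : ⨆ j, (hV j).measurableSpace ≤ m := iSup_le fun j => (hV j).measurableSpace_le
  rw [lintegral_mul_condExp hle (hM.martingale.integrable _) hh]
  refine lintegral_congr_ae ?_
  have h1 : ∀ᵐ ω ∂P, ∀ j, (a (V j ω) ω x : ℝ) =
      (P[fun ω => (a (C + 1) ω x : ℝ) | (hV j).measurableSpace]) ω :=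
    ae_all_iff.2 fun j => hM.stopped_ae_eq (hV j) (hC j)
  -- Lévy's upward theorem identifies the limit of the sampled values.
  have h2 := tendsto_ae_condExp (μ := P) (ℱ := 𝓖) (fun ω => (a (C + 1) ω x : ℝ))
  filter_upwards [h1, h2] with ω h1 h2
  by_cases hω : h ω = 0
  · simp [hω]
  have h3 : Tendsto (fun j => a (V j ω) ω x) atTop (𝓝 (leftVal a (S ω) ω x)) := by
    rcases eq_or_ne (S ω) 0 with hz | hz
    · have : ∀ j, V j ω = 0 := fun j =>
        nonpos_iff_eq_zero.1 (hz ▸ (hmono ω).ge_of_tendsto (hS ω) j)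
      simp only [hz, this, leftVal_zero]
      exact tendsto_const_nhds
    · exact tendsto_leftVal (hS ω)
        ((h0 ω hω).resolve_left hz) (hM.left_lim ω _)
  have h4 : Tendsto (fun j => (a (V j ω) ω x : ℝ)) atTop (𝓝 (leftVal a (S ω) ω x : ℝ)) :=
    (NNReal.continuous_coe.tendsto _).comp h3
  have h5 := tendsto_nhds_unique (h2.congr fun j => (h1 j).symm) h4
  rw [show (P[fun ω => (a (C + 1) ω x : ℝ) | ⨆ j, (hV j).measurableSpace]) ω =
    (leftVal a (S ω) ω x : ℝ) from h5, ENNReal.ofReal_coe_nnreal]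

end OptionalSampling

/-! ### Predictability of left limits with a parameter -/

section PredictableMeasurability

theorem measurable_indicator_of_inter {X β : Type*} [MeasurableSpace X] [MeasurableSpace β] [Zero β]
    {W : Set X} (hW : MeasurableSet W) {f : X → β}
    (hf : ∀ B, MeasurableSet B → MeasurableSet (W ∩ f ⁻¹' B)) : Measurable (W.indicator f) := by
  classical
  intro B hB
  rw [Set.indicator_preimage, Set.ite]
  refine MeasurableSet.union (by rw [Set.inter_comm]; exact hf B hB) (MeasurableSet.diff ?_ hW)
  exact measurable_zero hB

variable {X Y : Type*} {mX : MeasurableSpace X} [mY : MeasurableSpace Y]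

theorem measurable_predictable_fst (Q : Filtration ℝ≥0 mX) :
    Measurable[Q.predictable] (Prod.fst : ℝ≥0 × X → ℝ≥0) := by
  refine measurable_of_Ioi (mδ := Q.predictable) fun s => ?_
  have : Prod.fst ⁻¹' Set.Ioi s = Set.Ioi s ×ˢ (Set.univ : Set X) := by ext; simp
  rw [this]
  exact measurableSet_predictable_Ioi_prod MeasurableSet.univ

theorem measurableSet_predictable_prod {Q : Filtration ℝ≥0 mX} {q : ℝ≥0} {D : Set (X × Y)}
    (hD : MeasurableSet[(Q q).prod mY] D) :
    MeasurableSet[Q.predictable.prod mY]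
      {p : (ℝ≥0 × X) × Y | q < p.1.1 ∧ (p.1.2, p.2) ∈ D} := by
  let _ : MeasurableSpace X := Q q
  let _ : MeasurableSpace (ℝ≥0 × X) := Q.predictable
  have hq : MeasurableSet {p : (ℝ≥0 × X) × Y | q < p.1.1} :=
    ((measurable_predictable_fst Q).comp measurable_fst) measurableSet_Ioi
  refine MeasurableSpace.induction_on_inter (C := fun D _ =>
    MeasurableSet {p : (ℝ≥0 × X) × Y | q < p.1.1 ∧ (p.1.2, p.2) ∈ D})
    generateFrom_prod.symm isPiSystem_prod ?_ ?_ ?_ ?_ D hD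
  · simp
  · rintro _ ⟨A, hA, B, hB, rfl⟩
    have : {p : (ℝ≥0 × X) × Y | q < p.1.1 ∧ (p.1.2, p.2) ∈ A ×ˢ B} = (Set.Ioi q ×ˢ A) ×ˢ B := by
      ext; simp [and_assoc]
    rw [this]
    have h1 : MeasurableSet (Set.Ioi q ×ˢ A) := measurableSet_predictable_Ioi_prod hA
    exact h1.prod hB
  · intro A hA h
    convert hq.diff h using 1
    ext p
    simp only [Set.mem_ofPred_eq, Set.mem_compl_iff, Set.mem_sdiff]
    tauto
  · intro f _ _ h
    convert MeasurableSet.iUnion h using 1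
    ext p
    simp

/-- On `{q < s}` one may wait until `q + 1 / (n + 1)` for some `n`, when `f` is already known. -/
theorem measurable_predictable_indicator {β : Type*} [MeasurableSpace β] [Zero β]
    {Q : Filtration ℝ≥0 mX} {q : ℝ≥0} {f : X × Y → β}
    (hf : ∀ r > q, Measurable[(Q r).prod mY] f) :
    Measurable[Q.predictable.prod mY]
      ({p : (ℝ≥0 × X) × Y | q < p.1.1}.indicator fun p => f (p.1.2, p.2)) := by
  let _ : MeasurableSpace (ℝ≥0 × X) := Q.predictable
  refine measurable_indicator_of_inter
    (((measurable_predictable_fst Q).comp measurable_fst) measurableSet_Ioi) fun B hB => ?_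
  have : {p : (ℝ≥0 × X) × Y | q < p.1.1} ∩ (fun p => f (p.1.2, p.2)) ⁻¹' B =
      ⋃ n : ℕ, {p | q + 1 / ((n : ℝ≥0) + 1) < p.1.1 ∧ (p.1.2, p.2) ∈ f ⁻¹' B} := by
    ext p
    simp only [Set.mem_inter_iff, Set.mem_ofPred_eq, Set.mem_preimage, Set.mem_iUnion]
    constructor
    · rintro ⟨h, h'⟩
      obtain ⟨N, hN⟩ := exists_nat_one_div_lt (tsub_pos_of_lt h)
      exact ⟨N, lt_tsub_iff_left.1 hN, h'⟩
    · rintro ⟨n, h, h'⟩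
      exact ⟨le_self_add.trans_lt h, h'⟩
  refine (congrArg MeasurableSet this).mpr ?_
  exact MeasurableSet.iUnion fun n => measurableSet_predictable_prod
    (hf _ (lt_add_of_pos_right _ (by positivity)) hB)

theorem tendsto_floor_sub_two_div {v : ℝ≥0} (hv : 0 < v) :
    Tendsto (fun n : ℕ => ((⌊((n : ℝ≥0) + 1) * v⌋₊ - 2 : ℕ) : ℝ≥0) / ((n : ℝ≥0) + 1)) atTop
      (𝓝[<] v) := by
  have hlt : ∀ n : ℕ, ((⌊((n : ℝ≥0) + 1) * v⌋₊ - 2 : ℕ) : ℝ≥0) / ((n : ℝ≥0) + 1) < v := by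
    intro n
    rw [div_lt_iff₀ (by positivity), mul_comm v]
    rcases Nat.eq_zero_or_pos ⌊((n : ℝ≥0) + 1) * v⌋₊ with h | h
    · rw [h]; simp only [zero_tsub, Nat.cast_zero]; positivity
    · refine lt_of_lt_of_le ?_ (Nat.floor_le (by positivity))
      exact_mod_cast (by lia : ⌊((n : ℝ≥0) + 1) * v⌋₊ - 2 < ⌊((n : ℝ≥0) + 1) * v⌋₊)
  refine tendsto_nhdsWithin_iff.2 ⟨?_, .of_forall hlt⟩
  refine tendsto_of_tendsto_of_tendsto_of_le_of_le (g := fun n : ℕ => v - 3 * (1 / ((n : ℝ≥0) + 1)))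
    ?_ tendsto_const_nhds (fun n => ?_) fun n => (hlt n).le
  · have : Tendsto (fun n : ℕ => v - 3 * (1 / ((n : ℝ≥0) + 1))) atTop (𝓝 (v - 3 * 0)) :=
      tendsto_const_nhds.sub (tendsto_one_div_add_atTop_nhds_zero_nat.const_mul 3)
    simpa using this
  · simp only
    rw [tsub_le_iff_right, mul_one_div, ← add_div, le_div_iff₀ (by positivity), mul_comm v]
    refine (Nat.lt_floor_add_one _).le.trans ?_
    have : ⌊((n : ℝ≥0) + 1) * v⌋₊ + 1 ≤ (⌊((n : ℝ≥0) + 1) * v⌋₊ - 2) + 3 := by lia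
    exact_mod_cast this

/-- Left limits are predictable. -/
theorem measurable_leftLim {Q : Filtration ℝ≥0 mX} {α : ℝ≥0 → X × Y → ℝ≥0}
    (hα : ∀ t, ∀ r > t, Measurable[(Q r).prod mY] (α t))
    (hl : ∀ p t, ∃ l, Tendsto (fun s => α s p) (𝓝[<] t) (𝓝 l)) :
    Measurable[Q.predictable.prod mY] ({p : (ℝ≥0 × X) × Y | 0 < p.1.1}.indicator
      fun p => Function.leftLim (fun s => α s (p.1.2, p.2)) p.1.1) := by
  let _ : MeasurableSpace (ℝ≥0 × X) := Q.predictable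
  -- With `k = ⌊(n + 1) v⌋`, the value is sampled at `(k - 2) / (n + 1)` and released after `(k - 1)
  -- / (n + 1)`, which is still below `v`. The condition `2 ≤ k` excludes truncated subtraction; for
  -- fixed `v > 0` it holds eventually in `n`.
  let F : ℕ → ℕ → (ℝ≥0 × X) × Y → ℝ≥0 := fun n k =>
    {p : (ℝ≥0 × X) × Y | ((k - 1 : ℕ) : ℝ≥0) / ((n : ℝ≥0) + 1) < p.1.1 ∧ 2 ≤ k}.indicator
      fun p => α (((k - 2 : ℕ) : ℝ≥0) / ((n : ℝ≥0) + 1)) (p.1.2, p.2)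
  have hfst : Measurable fun p : (ℝ≥0 × X) × Y => p.1.1 :=
    (measurable_predictable_fst Q).comp measurable_fst
  have hF : ∀ n k, Measurable (F n k) := by
    intro n k
    by_cases hk : 2 ≤ k
    · have : (((k - 2 : ℕ) : ℝ≥0) / ((n : ℝ≥0) + 1)) < ((k - 1 : ℕ) : ℝ≥0) / ((n : ℝ≥0) + 1) := by
        gcongr
        lia
      have h := measurable_predictable_indicator (Q := Q)
        (q := ((k - 1 : ℕ) : ℝ≥0) / ((n : ℝ≥0) + 1)) fun r hr => hα _ r (this.trans hr)
      simpa only [F, hk, and_true] using h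
    · have : F n k = 0 := by
        ext p; simp [F, hk]
      rw [this]; exact measurable_zero
  refine measurable_of_tendsto_metrizable
    (f := fun n p => F n ⌊((n : ℝ≥0) + 1) * p.1.1⌋₊ p) (fun n => ?_) ?_
  · exact measurable_select (Nat.measurable_floor.comp (hfst.const_mul _)) (hF n)
  · rw [tendsto_pi_nhds]
    intro p
    by_cases hp : 0 < p.1.1
    · rw [Set.indicator_of_mem (show p ∈ {p : (ℝ≥0 × X) × Y | 0 < p.1.1} from hp)]
      have h1 := (tendsto_leftLim_of_tendsto (hl (p.1.2, p.2) p.1.1)).comp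
        (tendsto_floor_sub_two_div hp)
      refine h1.congr' ?_
      have h2 : ∀ᶠ n : ℕ in atTop, 2 ≤ ((n : ℝ≥0) + 1) * p.1.1 := by
        have : Tendsto (fun n : ℕ => (n : ℝ≥0) * p.1.1) atTop atTop :=
          tendsto_natCast_atTop_atTop.atTop_mul_const hp
        filter_upwards [this.eventually_ge_atTop 2] with n hn
        exact hn.trans (by gcongr; exact le_self_add)
      filter_upwards [h2] with n hn
      have h3 : 2 ≤ ⌊((n : ℝ≥0) + 1) * p.1.1⌋₊ := Nat.le_floor (by exact_mod_cast hn)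
      have h4 : ((⌊((n : ℝ≥0) + 1) * p.1.1⌋₊ - 1 : ℕ) : ℝ≥0) / ((n : ℝ≥0) + 1) < p.1.1 := by
        rw [div_lt_iff₀ (by positivity), mul_comm p.1.1]
        refine lt_of_lt_of_le ?_ (Nat.floor_le (by positivity))
        exact_mod_cast (by lia : ⌊((n : ℝ≥0) + 1) * p.1.1⌋₊ - 1 < ⌊((n : ℝ≥0) + 1) * p.1.1⌋₊)
      simp only [F, Function.comp]
      rw [Set.indicator_of_mem]
      exact ⟨h4, h3⟩
    · have h0 : p.1.1 = 0 := by simpa using hp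
      rw [Set.indicator_of_notMem (show p ∉ {p : (ℝ≥0 × X) × Y | 0 < p.1.1} from hp)]
      simp [F, h0]

theorem measurable_predictable_zero_indicator {β : Type*} [MeasurableSpace β] [Zero β]
    {Q : Filtration ℝ≥0 mX} {f : X → β} (hf : Measurable[Q 0] f) :
    Measurable[Q.predictable] ({p : ℝ≥0 × X | p.1 = 0}.indicator fun p => f p.2) := by
  refine @measurable_indicator_of_inter _ _ Q.predictable _ _ _
    (measurable_predictable_fst Q (measurableSet_singleton 0)) _ fun B hB => ?_
  exact measurableSet_predictable_singleton_bot_prod (hf hB)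

theorem measurable_leftLim_predictable {K : Filtration ℝ≥0 mX} {β : ℝ≥0 → X → ℝ≥0}
    (hβ : ∀ t, ∀ r > t, Measurable[K r] (β t))
    (hl : ∀ x t, ∃ l, Tendsto (fun s => β s x) (𝓝[<] t) (𝓝 l)) :
    Measurable[K.rightCont.predictable] fun p : ℝ≥0 × X =>
      Function.leftLim (fun s => β s p.2) p.1 := by
  have h1 := measurable_leftLim (Q := K.rightCont) (Y := Unit) (α := fun s p => β s p.1)
    (fun t r hr => ((hβ t r hr).mono (K.le_rightCont r) le_rfl).comp
      (@measurable_fst _ _ (K.rightCont r) _)) (fun p t => hl p.1 t)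
  have h2 := measurable_predictable_zero_indicator (Q := K.rightCont)
    (measurable_rightCont_iff.2 (hβ 0))
  let _ : MeasurableSpace (ℝ≥0 × X) := K.rightCont.predictable
  have h1' := h1.comp (measurable_id.prodMk measurable_const : Measurable fun p : ℝ≥0 × X => (p, ()))
  convert h1'.add h2 using 1
  ext p
  rcases eq_or_ne p.1 0 with hp | hp
  · have : Function.leftLim (fun s => β s p.2) 0 = β 0 p.2 := leftLim_eq_of_isBot fun _ => zero_le
    simp [Set.indicator, hp, this]
  · simp [Set.indicator, hp, pos_iff_ne_zero]

end PredictableMeasurability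

/-! ### Measurability of the Bayes ratio -/

section RatioMeasurability

/-- `x / y` on `{y > 0}` and `0` elsewhere. -/
noncomputable def safeDiv (x : ℝ≥0∞) (y : ℝ≥0) : ℝ≥0∞ := if 0 < y then x / (y : ℝ≥0∞) else 0

theorem safeDiv_mul (x : ℝ≥0∞) (y : ℝ≥0) :
    safeDiv x y * (y : ℝ≥0∞) = if y = 0 then 0 else x := by
  rcases eq_or_ne y 0 with rfl | h
  · simp
  · rw [safeDiv, if_pos (pos_iff_ne_zero.2 h), if_neg h]
    exact ENNReal.div_mul_cancel (by simpa using h) ENNReal.coe_ne_top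

theorem measurable_safeDiv : Measurable fun p : ℝ≥0∞ × ℝ≥0 => safeDiv p.1 p.2 := by
  unfold safeDiv
  refine Measurable.ite ?_ (measurable_fst.div (by fun_prop)) measurable_const
  exact measurable_snd measurableSet_Ioi

theorem measurable_safeDiv_comp {X : Type*} {mX : MeasurableSpace X} {f : X → ℝ≥0∞} {h : X → ℝ≥0}
    (hf : Measurable f) (hh : Measurable h) : Measurable fun x => safeDiv (f x) (h x) :=
  measurable_safeDiv.comp (hf.prodMk hh)

variable {X Y : Type*} {mX : MeasurableSpace X} [mY : MeasurableSpace Y] (κ : Measure Y) [SFinite κ]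
  {K : Filtration ℝ≥0 mX} {α : ℝ≥0 → X × Y → ℝ≥0} {β : ℝ≥0 → X → ℝ≥0} {γ : X × Y → ℝ≥0∞}
  {t : ℝ≥0}

/-- The indicator is essential: `γ` is known only immediately after `t`, so the numerator belongs to
the past of `S` only on `{t ≤ S}`. -/
theorem measurable_ratio_stopped
    (hα : ∀ t, ∀ r > t, Measurable[(K r).prod mY] (α t))
    (hαr : ∀ p t, ContinuousWithinAt (fun s => α s p) (Set.Ici t) t)
    (hβ : ∀ t, ∀ r > t, Measurable[K r] (β t))
    (hβr : ∀ x t, ContinuousWithinAt (fun s => β s x) (Set.Ici t) t)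
    (hγ : ∀ r > t, Measurable[(K r).prod mY] γ)
    {S : X → ℝ≥0} (hS : IsStoppingTime K.rightCont fun x => (S x : WithTop ℝ≥0)) :
    Measurable[hS.measurableSpace] ({x | t ≤ S x}.indicator fun x =>
      safeDiv (∫⁻ y, γ (x, y) * (α (S x) (x, y) : ℝ≥0∞) ∂κ) (β (S x) x)) := by
  have hnum : Measurable[hS.measurableSpace] ({x | t ≤ S x}.indicator fun x =>
      ∫⁻ y, γ (x, y) * (α (S x) (x, y) : ℝ≥0∞) ∂κ) := by
    refine measurable_of_indicator_le hS fun s => ?_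
    rw [Set.indicator_indicator]
    rcases lt_or_ge s t with hst | hst
    · have : {x | S x ≤ s} ∩ {x | t ≤ S x} = ∅ := by
        ext x
        simp only [Set.mem_inter_iff, Set.mem_ofPred_eq, Set.mem_empty_iff_false, iff_false, not_and,
          not_le]
        exact fun h => h.trans_lt hst
      rw [this, Set.indicator_empty]
      exact @measurable_const _ _ _ (K.rightCont s) _
    · refine measurable_rightCont_iff.2 fun r hr => ?_
      have h1 : MeasurableSet[K r] {x | S x ≤ s} := by
        convert rightCont_le_of_lt K hr _ (hS s) using 1
        ext; simp only [Set.mem_ofPred_eq, WithTop.coe_le_coe]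
      have h2 : MeasurableSet[K r] {x | t ≤ S x} := by
        convert rightCont_le_of_lt K (hst.trans_lt hr) _ (hS.measurableSet_ge t) using 1
        ext; simp only [Set.mem_ofPred_eq, WithTop.coe_le_coe]
      have hmin := measurable_min_const_stoppingTime hS s
      have h3 : Measurable[K r] fun x =>
          ∫⁻ y, γ (x, y) * (α (min (S x) s) (x, y) : ℝ≥0∞) ∂κ := by
        let _ : MeasurableSpace X := K r
        have h4 := measurable_min_const_of_rightContinuous hr (fun t ht => hα t r ht) hαr
        have h5 : Measurable fun p : X × Y => (S p.1 ⊓ s, p) :=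
          ((hmin.mono (rightCont_le_of_lt K hr) le_rfl).comp measurable_fst).prodMk measurable_id
        have h6 : Measurable fun p : X × Y => α (S p.1 ⊓ s) p := by
          simpa [Function.comp_def] using h4.comp h5
        exact Measurable.lintegral_prod_right' (f := fun p : X × Y =>
          γ p * (α (S p.1 ⊓ s) p : ℝ≥0∞)) ((hγ r (hst.trans_lt hr)).mul h6.coe_nnreal_ennreal)
      convert Measurable.indicator h3 (MeasurableSet.inter h1 h2) using 1
      refine Set.indicator_congr fun x hx => ?_
      rw [min_eq_left hx.1]
  have hden : Measurable[hS.measurableSpace] fun x => β (S x) x :=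
    measurable_stopped_of_rightContinuous (fun t => measurable_rightCont_iff.2 (hβ t)) hβr hS
  convert measurable_safeDiv_comp hnum hden using 1
  ext x
  by_cases hx : t ≤ S x
  · simp [Set.indicator, hx]
  · simp [Set.indicator, hx, safeDiv]

theorem measurable_ratio_leftLim
    (hα : ∀ t, ∀ r > t, Measurable[(K r).prod mY] (α t))
    (hαl : ∀ p t, ∃ l, Tendsto (fun s => α s p) (𝓝[<] t) (𝓝 l))
    (hβ : ∀ t, ∀ r > t, Measurable[K r] (β t))
    (hβl : ∀ x t, ∃ l, Tendsto (fun s => β s x) (𝓝[<] t) (𝓝 l))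
    (hγ : ∀ r > t, Measurable[(K r).prod mY] γ) :
    Measurable[K.rightCont.predictable] ({p : ℝ≥0 × X | t < p.1 ∨ t = 0}.indicator fun p =>
      safeDiv (∫⁻ y, γ (p.2, y) * ((Function.leftLim (fun s => α s (p.2, y)) p.1 : ℝ≥0) : ℝ≥0∞) ∂κ)
        (Function.leftLim (fun s => β s p.2) p.1)) := by
  set G : ℝ≥0 × X → ℝ≥0∞ := fun p =>
      safeDiv (∫⁻ y, γ (p.2, y) * ((Function.leftLim (fun s => α s (p.2, y)) p.1 : ℝ≥0) : ℝ≥0∞) ∂κ)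
        (Function.leftLim (fun s => β s p.2) p.1) with hG
  have hKle : ∀ r, (K r).prod mY ≤ (K.rightCont r).prod mY := fun r =>
    sup_le_sup (MeasurableSpace.comap_mono (K.le_rightCont r)) le_rfl
  have h1 : Measurable[K.rightCont.predictable] ({p : ℝ≥0 × X | t < p.1}.indicator G) := by
    have hden := measurable_leftLim_predictable hβ hβl
    have hnum1 := measurable_leftLim (Q := K.rightCont) (fun t r hr => (hα t r hr).mono (hKle r) le_rfl)
      hαl
    have hnum2 := measurable_predictable_indicator (Q := K.rightCont)
      (fun r hr => (hγ r hr).mono (hKle r) le_rfl)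
    let _ : MeasurableSpace (ℝ≥0 × X) := K.rightCont.predictable
    have hnum := (hnum2.mul hnum1.coe_nnreal_ennreal).lintegral_prod_right' (ν := κ)
    convert measurable_safeDiv_comp hnum hden using 1
    ext p
    by_cases hp : t < p.1
    · have hp0 : 0 < p.1 := (zero_le).trans_lt hp
      simp [Set.indicator, hp, hp0, hG]
    · simp [Set.indicator, hp, safeDiv]
  rcases eq_or_ne t 0 with rfl | ht
  -- For `t = 0` the slice at time `0` must be added, where left limits are values at `0`.
  · have h2 : Measurable[K.rightCont.predictable] ({p : ℝ≥0 × X | p.1 = 0}.indicator G) := by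
      have h0 : Measurable[K.rightCont 0] fun x =>
          safeDiv (∫⁻ y, γ (x, y) * (α 0 (x, y) : ℝ≥0∞) ∂κ) (β 0 x) := by
        refine measurable_rightCont_iff.2 fun r hr => ?_
        let _ : MeasurableSpace X := K r
        exact measurable_safeDiv_comp
          (((hγ r hr).mul (hα 0 r hr).coe_nnreal_ennreal).lintegral_prod_right' (ν := κ)) (hβ 0 r hr)
      convert measurable_predictable_zero_indicator h0 using 1
      refine Set.indicator_congr fun p hp => ?_
      have hp : p.1 = 0 := hp
      have hbot : ∀ f : ℝ≥0 → ℝ≥0, Function.leftLim f 0 = f 0 := fun f =>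
        leftLim_eq_of_isBot fun _ => zero_le
      simp only [hG, hp, hbot]
    let _ : MeasurableSpace (ℝ≥0 × X) := K.rightCont.predictable
    convert h1.add h2 using 1
    ext p
    rcases eq_or_ne p.1 0 with hp | hp
    · simp [Set.indicator, hp]
    · simp [Set.indicator, hp]
  · simpa only [ht, or_false] using h1

end RatioMeasurability

/-! ### The abstract Bayes formula -/

section Bayes

variable {Ω Z Y : Type*} {m : MeasurableSpace Ω} [mZ : MeasurableSpace Z] [mY : MeasurableSpace Y]
  {P : Measure Ω} [SFinite P] {ν : Measure Z} [SFinite ν] {κ : Measure Y} [SFinite κ]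

theorem lintegral_prod_congr_sections {F G : Ω × Z → ℝ≥0∞} (hF : Measurable F) (hG : Measurable G)
    (h : ∀ z, ∫⁻ ω, F (ω, z) ∂P = ∫⁻ ω, G (ω, z) ∂P) :
    ∫⁻ p, F p ∂(P.prod ν) = ∫⁻ p, G p ∂(P.prod ν) := by
  rw [lintegral_prod_symm' _ hF, lintegral_prod_symm' _ hG]
  exact lintegral_congr h

theorem lintegral_prod_congr_sections₂ {F G : (Ω × Z) × Y → ℝ≥0∞} (hF : Measurable F)
    (hG : Measurable G) (h : ∀ z y, ∫⁻ ω, F ((ω, z), y) ∂P = ∫⁻ ω, G ((ω, z), y) ∂P) :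
    ∫⁻ p, ∫⁻ y, F (p, y) ∂κ ∂(P.prod ν) = ∫⁻ p, ∫⁻ y, G (p, y) ∂κ ∂(P.prod ν) := by
  refine lintegral_prod_congr_sections hF.lintegral_prod_right' hG.lintegral_prod_right' fun z => ?_
  have hz : Measurable fun q : Ω × Y => ((q.1, z), q.2) := by fun_prop
  rw [lintegral_lintegral_swap (f := fun ω y => F ((ω, z), y)) (hF.comp hz).aemeasurable,
    lintegral_lintegral_swap (f := fun ω y => G ((ω, z), y)) (hG.comp hz).aemeasurable]
  exact lintegral_congr fun y => h z y

/-- An abstract Bayes formula. The density of `((ω, ξ), η)` is `aT`, and `b`, `bJ` are versions of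
`aT`, `aJT` projected on the σ-algebras `𝓢 z` of the sections of `𝓗`. -/
theorem lintegral_indicator_bayes {ξ : Ω → Z} {η : Ω → Y}
    {aT b : (Ω × Z) × Y → ℝ≥0} {aJT bJ : Ω × Z → ℝ≥0} {g : (Ω × Z) × Y → ℝ≥0∞}
    (haT : Measurable aT) (haJT : Measurable aJT)
    (hmarg : ∀ᵐ p ∂(P.prod ν), (aJT p : ℝ≥0∞) = ∫⁻ y, (aT (p, y) : ℝ≥0∞) ∂κ)
    {E : Set (Ω × Z)}
    (hb : Measurable ({p : (Ω × Z) × Y | p.1 ∈ E}.indicator b))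
    {𝓣 𝓗 : MeasurableSpace (Ω × Z)} (h𝓣 : 𝓣 ≤ m.prod mZ) (h𝓗 : 𝓗 ≤ 𝓣)
    {𝓢 : Z → MeasurableSpace Ω} (hsec : ∀ z, Measurable[𝓢 z, 𝓗] (fun ω => (ω, z)))
    (hgE : Measurable[𝓣.prod mY] fun q : (Ω × Z) × Y => E.indicator (fun p => g (p, q.2)) q.1)
    (hdens : ∀ f : (Ω × Z) × Y → ℝ≥0∞, Measurable[𝓣.prod mY] f →
      ∫⁻ ω, f ((ω, ξ ω), η ω) ∂P = ∫⁻ p, ∫⁻ y, f (p, y) * (aT (p, y) : ℝ≥0∞) ∂κ ∂(P.prod ν))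
    (hE : MeasurableSet[𝓗] E)
    (hbJ : Measurable[𝓗] (E.indicator bJ))
    (hgsec : ∀ z y, Measurable[𝓢 z] fun ω => E.indicator (fun p => g (p, y)) (ω, z))
    (hOS : ∀ z y (h : Ω → ℝ≥0∞), Measurable[𝓢 z] h → (∀ ω, h ω ≠ 0 → (ω, z) ∈ E) →
      ∫⁻ ω, h ω * (aT ((ω, z), y) : ℝ≥0∞) ∂P = ∫⁻ ω, h ω * (b ((ω, z), y) : ℝ≥0∞) ∂P)
    (hOSJ : ∀ z (h : Ω → ℝ≥0∞), Measurable[𝓢 z] h → (∀ ω, h ω ≠ 0 → (ω, z) ∈ E) →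
      ∫⁻ ω, h ω * (aJT (ω, z) : ℝ≥0∞) ∂P = ∫⁻ ω, h ω * (bJ (ω, z) : ℝ≥0∞) ∂P)
    (hX : Measurable[𝓗]
      (E.indicator fun p => safeDiv (∫⁻ y, g (p, y) * (b (p, y) : ℝ≥0∞) ∂κ) (bJ p))) :
    ∫⁻ ω, E.indicator (fun p => g (p, η ω)) (ω, ξ ω) ∂P =
      ∫⁻ ω, E.indicator (fun p => safeDiv (∫⁻ y, g (p, y) * (b (p, y) : ℝ≥0∞) ∂κ) (bJ p))
        (ω, ξ ω) ∂P := by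
  set X : Ω × Z → ℝ≥0∞ := fun p => safeDiv (∫⁻ y, g (p, y) * (b (p, y) : ℝ≥0∞) ∂κ) (bJ p) with hXdef
  set b' : (Ω × Z) × Y → ℝ≥0 := {p : (Ω × Z) × Y | p.1 ∈ E}.indicator b with hb'
  have hb'E : ∀ p y, p ∈ E → b' (p, y) = b (p, y) := fun p y hp =>
    Set.indicator_of_mem (show (p, y) ∈ {p : (Ω × Z) × Y | p.1 ∈ E} from hp) _
  have hprod : 𝓣.prod mY ≤ (m.prod mZ).prod mY :=
    sup_le_sup (MeasurableSpace.comap_mono h𝓣) le_rfl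
  -- Integrated against functions supported in `E`, the terminal density may be exchanged for `b`:
  -- freeze `(z, y)` by Tonelli and apply optional sampling.
  have hsw : ∀ φ : (Ω × Z) × Y → ℝ≥0∞, Measurable[(m.prod mZ).prod mY] φ →
      (∀ z y, Measurable[𝓢 z] fun ω => φ ((ω, z), y)) →
      (∀ p y, φ (p, y) ≠ 0 → p ∈ E) →
      ∫⁻ p, ∫⁻ y, φ (p, y) * (aT (p, y) : ℝ≥0∞) ∂κ ∂(P.prod ν) =
        ∫⁻ p, ∫⁻ y, φ (p, y) * (b' (p, y) : ℝ≥0∞) ∂κ ∂(P.prod ν) := by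
    intro φ hφ hφs hφE
    refine lintegral_prod_congr_sections₂ (F := fun q => φ q * (aT q : ℝ≥0∞))
      (G := fun q => φ q * (b' q : ℝ≥0∞)) (hφ.mul haT.coe_nnreal_ennreal)
      (hφ.mul hb.coe_nnreal_ennreal) fun z y => ?_
    rw [hOS z y _ (hφs z y) fun ω => hφE _ y]
    refine lintegral_congr fun ω => ?_
    by_cases h0 : φ ((ω, z), y) = 0
    · simp [h0]
    · rw [hb'E _ _ (hφE _ _ h0)]
  have hbJm : Measurable[m.prod mZ] (E.indicator bJ) := hbJ.mono (h𝓗.trans h𝓣) le_rfl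
  -- The exchange for the marginal: at the terminal time `aJT` is the integral of `aT`, and optional
  -- sampling for `aJT` then gives `bJ`.
  have hswJ : ∀ ψ : Ω × Z → ℝ≥0∞, Measurable[𝓗] ψ → (∀ p, ψ p ≠ 0 → p ∈ E) →
      ∫⁻ p, ψ p * (∫⁻ y, (aT (p, y) : ℝ≥0∞) ∂κ) ∂(P.prod ν) =
        ∫⁻ p, ψ p * (bJ p : ℝ≥0∞) ∂(P.prod ν) := by
    intro ψ hψ hψE
    have hψm : Measurable[m.prod mZ] ψ := hψ.mono (h𝓗.trans h𝓣) le_rfl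
    have h1 : ∀ p, ψ p * (bJ p : ℝ≥0∞) = ψ p * ((E.indicator bJ p : ℝ≥0) : ℝ≥0∞) := by
      intro p
      by_cases h0 : ψ p = 0
      · simp [h0]
      · rw [Set.indicator_of_mem (hψE p h0)]
    rw [lintegral_congr h1, ← lintegral_congr_ae (hmarg.mono fun p hp => by
      simp only
      rw [hp] : (fun p => ψ p * (aJT p : ℝ≥0∞)) =ᵐ[P.prod ν] _)]
    refine lintegral_prod_congr_sections (hψm.mul haJT.coe_nnreal_ennreal)
      (hψm.mul hbJm.coe_nnreal_ennreal) fun z => ?_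
    exact (hOSJ z _ (hψ.comp (hsec z)) fun ω => hψE _).trans (lintegral_congr fun ω => h1 _)
  -- the left-hand side
  rw [hdens (fun q => E.indicator (fun p => g (p, q.2)) q.1) hgE,
    hsw (fun q => E.indicator (fun p => g (p, q.2)) q.1) (hgE.mono hprod le_rfl) hgsec
      fun p y => Set.mem_of_indicator_ne_zero]
  -- the right-hand side
  have hXm : Measurable[𝓣.prod mY] fun q : (Ω × Z) × Y => E.indicator X q.1 :=
    (hX.mono h𝓗 le_rfl).comp (@measurable_fst _ _ 𝓣 mY)
  have hXsec : ∀ p, ∫⁻ y, E.indicator X p * (aT (p, y) : ℝ≥0∞) ∂κ =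
      E.indicator X p * ∫⁻ y, (aT (p, y) : ℝ≥0∞) ∂κ := fun p =>
    lintegral_const_mul _ (haT.comp (@measurable_prodMk_left _ _ (m.prod mZ) mY p)).coe_nnreal_ennreal
  rw [hdens (fun q => E.indicator X q.1) hXm, lintegral_congr hXsec,
    hswJ _ hX fun p => Set.mem_of_indicator_ne_zero]
  -- the set where the denominator vanishes
  set E₀ : Set (Ω × Z) := E ∩ E.indicator bJ ⁻¹' {0} with hE₀
  have hE₀m : MeasurableSet[𝓗] E₀ := hE.inter (hbJ (measurableSet_singleton 0))
  have h1m : Measurable[𝓗] (E₀.indicator fun _ => (1 : ℝ≥0∞)) :=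
    (@measurable_const _ _ _ 𝓗 _).indicator hE₀m
  -- Exchanging `b` for `aT`, integrating in `y`, and exchanging `aJT` for `bJ` shows that `b` has
  -- no mass over `{bJ = 0}`. This is why the ratio may be set to `0` there.
  have h0 : ∫⁻ p, ∫⁻ y, E₀.indicator (fun _ => (1 : ℝ≥0∞)) p * (b' (p, y) : ℝ≥0∞) ∂κ ∂(P.prod ν) = 0 := by
    rw [← hsw (fun q => E₀.indicator (fun _ => (1 : ℝ≥0∞)) q.1)
      ((h1m.mono (h𝓗.trans h𝓣) le_rfl).comp (@measurable_fst _ _ (m.prod mZ) mY)) (fun z y => h1m.comp (hsec z))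
      fun p y h => (Set.mem_of_indicator_ne_zero h).1]
    have : ∀ p, ∫⁻ y, E₀.indicator (fun _ => (1 : ℝ≥0∞)) p * (aT (p, y) : ℝ≥0∞) ∂κ =
        E₀.indicator (fun _ => (1 : ℝ≥0∞)) p * ∫⁻ y, (aT (p, y) : ℝ≥0∞) ∂κ := fun p =>
      lintegral_const_mul _ (haT.comp (@measurable_prodMk_left _ _ (m.prod mZ) mY p)).coe_nnreal_ennreal
    simp only [this]
    rw [hswJ _ h1m fun p h => (Set.mem_of_indicator_ne_zero h).1]
    refine (lintegral_congr fun p => ?_).trans lintegral_zero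
    by_cases hp : p ∈ E₀
    · have h2 : bJ p = 0 := by
        have := hp.2
        rwa [Set.mem_preimage, Set.indicator_of_mem hp.1] at this
      simp [h2]
    · simp [hp]
  have h0m : Measurable[m.prod mZ] fun p => ∫⁻ y, E₀.indicator (fun _ => (1 : ℝ≥0∞)) p * (b' (p, y) : ℝ≥0∞) ∂κ := by
    refine @Measurable.lintegral_prod_right' _ _ (m.prod mZ) mY κ _ (f := fun q : (Ω × Z) × Y =>
      E₀.indicator (fun _ => (1 : ℝ≥0∞)) q.1 * (b' q : ℝ≥0∞)) ?_
    exact ((h1m.mono (h𝓗.trans h𝓣) le_rfl).comp (@measurable_fst _ _ (m.prod mZ) mY)).mul hb.coe_nnreal_ennreal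
  have hae := (lintegral_eq_zero_iff h0m).1 h0
  refine lintegral_congr_ae (hae.mono fun p hp => ?_)
  simp only [Pi.zero_apply] at hp ⊢
  by_cases hpE : p ∈ E
  · simp only [Set.indicator_of_mem hpE, hb'E p _ hpE]
    rw [hXdef, safeDiv_mul]
    split_ifs with hz
    · have hpE₀ : p ∈ E₀ := ⟨hpE, by
        rw [Set.mem_preimage, Set.indicator_of_mem hpE]
        exact hz⟩
      have hbp : Measurable fun y => b (p, y) := by
        have : (fun y => b (p, y)) = fun y => b' (p, y) := by
          ext y; rw [hb'E p y hpE]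
        rw [this]
        exact hb.comp (@measurable_prodMk_left _ _ (m.prod mZ) mY p)
      simp only [Set.indicator_of_mem hpE₀, one_mul, hb'E p _ hpE] at hp
      rw [lintegral_eq_zero_iff hbp.coe_nnreal_ennreal] at hp
      refine (lintegral_congr_ae (hp.mono fun y hy => ?_)).trans lintegral_zero
      simp only [Pi.zero_apply] at hy ⊢
      rw [hy, mul_zero]
    · rfl
  · simp [hpE]

end Bayes

/-! ### The joint law of the scenario and the random times -/

section Density

variable {Ω : Type*} {m : MeasurableSpace Ω} {P : Measure Ω} [IsProbabilityMeasure P]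
  {𝔽 : Filtration ℝ≥0 m} {μ : Measure ℝ≥0} [SigmaFinite μ]

/-- Integrating the density hypothesis over `A ∈ 𝔽 T` settles rectangles `A ×ˢ B`, and these form a
π-system generating `𝔽 T ⊗ 𝓑`. Both measures therefore live on that smaller σ-algebra. -/
theorem IsConditionalDensity.lintegral_eq {ι : Type*} [Fintype ι] {τ : Ω → ι → ℝ≥0}
    (hτ : Measurable τ) {a : ℝ≥0 → Ω → (ι → ℝ≥0) → ℝ≥0} (ha : IsConditionalDensity P 𝔽 μ τ a)
    {T : ℝ≥0} (haT : Measurable fun p : Ω × (ι → ℝ≥0) => a T p.1 p.2)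
    {f : Ω × (ι → ℝ≥0) → ℝ≥0∞} (hf : Measurable[(𝔽 T).prod MeasurableSpace.pi] f) :
    ∫⁻ ω, f (ω, τ ω) ∂P =
      ∫⁻ ω, ∫⁻ u, f (ω, u) * (a T ω u : ℝ≥0∞) ∂(Measure.pi fun _ : ι => μ) ∂P := by
  classical
  set μn := Measure.pi fun _ : ι => μ
  set 𝓐 : MeasurableSpace (Ω × (ι → ℝ≥0)) := (𝔽 T).prod MeasurableSpace.pi with h𝓐
  have hle : 𝓐 ≤ m.prod MeasurableSpace.pi :=
    sup_le_sup (MeasurableSpace.comap_mono (𝔽.le T)) le_rfl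
  have hι : Measurable[m, 𝓐] fun ω => (ω, τ ω) :=
    (measurable_id.prodMk hτ).mono le_rfl hle
  let Q₁ : Measure[𝓐] (Ω × (ι → ℝ≥0)) := @Measure.map _ _ m 𝓐 (fun ω => (ω, τ ω)) P
  let Q₂ : Measure[𝓐] (Ω × (ι → ℝ≥0)) :=
    ((P.prod μn).withDensity fun p => (a T p.1 p.2 : ℝ≥0∞)).trim hle
  have hQ₂ : ∀ {h : Ω × (ι → ℝ≥0) → ℝ≥0∞}, Measurable[𝓐] h →
      ∫⁻ p, h p ∂Q₂ = ∫⁻ ω, ∫⁻ u, h (ω, u) * (a T ω u : ℝ≥0∞) ∂μn ∂P := by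
    intro h hh
    have hh' := hh.mono hle le_rfl
    rw [lintegral_trim hle hh, lintegral_withDensity_eq_lintegral_mul _ haT.coe_nnreal_ennreal hh',
      lintegral_prod _ (haT.coe_nnreal_ennreal.mul hh').aemeasurable]
    simp [mul_comm]
  have hQ₁ : ∀ {h : Ω × (ι → ℝ≥0) → ℝ≥0∞}, Measurable[𝓐] h →
      ∫⁻ p, h p ∂Q₁ = ∫⁻ ω, h (ω, τ ω) ∂P := fun hh => lintegral_map hh hι
  have hrect : ∀ A B, MeasurableSet[𝔽 T] A → MeasurableSet B → Q₁ (A ×ˢ B) = Q₂ (A ×ˢ B) := by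
    intro A B hA hB
    have hAB : MeasurableSet[𝓐] (A ×ˢ B) := by
      let _ : MeasurableSpace Ω := 𝔽 T
      exact hA.prod hB
    rw [← lintegral_indicator_one hAB, ← lintegral_indicator_one hAB,
      hQ₁ (measurable_one.indicator hAB), hQ₂ (measurable_one.indicator hAB)]
    have h1 := setLIntegral_condLExp (𝔽.le T) P (fun ω => B.indicator (1 : (ι → ℝ≥0) → ℝ≥0∞) (τ ω)) hA
    rw [setLIntegral_congr_fun_ae (𝔽.le T _ hA)
      ((ha (B.indicator 1) (measurable_one.indicator hB) T).mono fun ω h _ => h),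
      ← lintegral_indicator (𝔽.le T _ hA), ← lintegral_indicator (𝔽.le T _ hA)] at h1
    have hind : ∀ ω u, (A ×ˢ B).indicator (1 : Ω × (ι → ℝ≥0) → ℝ≥0∞) (ω, u) =
        if ω ∈ A then B.indicator (1 : (ι → ℝ≥0) → ℝ≥0∞) u else 0 := by
      intro ω u
      by_cases h1 : ω ∈ A <;> by_cases h2 : u ∈ B <;> simp [h1, h2]
    convert h1.symm using 1
    · refine lintegral_congr fun ω => ?_
      by_cases hω : ω ∈ A
      · rw [hind, if_pos hω, Set.indicator_of_mem hω]
      · rw [Set.indicator_of_notMem hω, hind, if_neg hω]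
    · refine lintegral_congr fun ω => ?_
      by_cases hω : ω ∈ A
      · rw [Set.indicator_of_mem hω]
        exact lintegral_congr fun u => by rw [hind, if_pos hω]
      · rw [Set.indicator_of_notMem hω]
        simp [hω]
  have hfin : IsFiniteMeasure Q₁ := by
    exact @Measure.isFiniteMeasure_map _ _ 𝓐 m P _ _
  have hQ : Q₁ = Q₂ := by
    refine @ext_of_generate_finite _ 𝓐 Q₁ Q₂ _ (@generateFrom_prod _ _ (𝔽 T) _).symm
      (@isPiSystem_prod _ _ (𝔽 T) _) hfin ?_ ?_
    · rintro _ ⟨A, hA, B, hB, rfl⟩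
      exact hrect A B hA hB
    · rw [← Set.univ_prod_univ]
      exact hrect _ _ MeasurableSet.univ MeasurableSet.univ
  rw [← hQ₁ hf, ← hQ₂ hf, hQ]

variable {n : ℕ}

theorem glue_sub {β : Type*} (J : Finset (Fin n)) (x : Fin n → β) :
    glue J (sub J x) (fun i => x i) = x := by
  ext i
  simp [glue, sub]

theorem sub_glue {β : Type*} (J : Finset (Fin n)) (z : {i // i ∈ J} → β) (y : {i // i ∉ J} → β) :
    sub J (glue J z y) = z := by
  ext i
  simp [glue, sub]

theorem compl_glue {β : Type*} (J : Finset (Fin n)) (z : {i // i ∈ J} → β) (y : {i // i ∉ J} → β)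
    (i : {i // i ∉ J}) : glue J z y i = y i := by
  simp [glue, i.2]

theorem measurable_glue (J : Finset (Fin n)) : Measurable
    fun p : ({i // i ∈ J} → ℝ≥0) × ({i // i ∉ J} → ℝ≥0) => glue J p.1 p.2 := by
  refine measurable_pi_lambda _ fun i => ?_
  unfold glue
  split_ifs with h <;> fun_prop

theorem lintegral_pi_eq_glue (J : Finset (Fin n)) {F : (Fin n → ℝ≥0) → ℝ≥0∞} (hF : Measurable F) :
    ∫⁻ u, F u ∂(Measure.pi fun _ : Fin n => μ) =
      ∫⁻ z, ∫⁻ y, F (glue J z y) ∂(Measure.pi fun _ : {i // i ∉ J} => μ)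
        ∂(Measure.pi fun _ : {i // i ∈ J} => μ) := by
  have h := (measurePreserving_piEquivPiSubtypeProd (fun _ : Fin n => μ) (fun i => i ∈ J)).symm
  rw [← h.lintegral_comp hF, lintegral_prod]
  · congr!
  · exact (hF.comp (MeasurableEquiv.measurable _)).aemeasurable

end Density

/-! ### Identifying a conditional expectation on an event -/

section Uniqueness

variable {Ω : Type*} {m : MeasurableSpace Ω} {P : Measure Ω} [IsProbabilityMeasure P]

/-- The candidate `X` is controlled only on `W`; completing it off `W` by the conditional
expectation itself gives a global candidate to which uniqueness applies. -/
theorem condLExp_ae_eq_of_setLIntegral_eq_on {𝓗 : MeasurableSpace Ω} (h𝓗 : 𝓗 ≤ m)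
    {f X : Ω → ℝ≥0∞} {W : Set Ω} (hW : MeasurableSet[𝓗] W) (hX : Measurable[𝓗] (W.indicator X))
    (h : ∀ A, MeasurableSet[𝓗] A → A ⊆ W → ∫⁻ ω in A, f ω ∂P = ∫⁻ ω in A, X ω ∂P) :
    ∀ᵐ ω ∂P, ω ∈ W → (P⁻[f | 𝓗]) ω = X ω := by
  have hc := measurable_condLExp 𝓗 P f
  have hY : Measurable[𝓗] (W.indicator X + Wᶜ.indicator (P⁻[f | 𝓗])) :=
    hX.add (hc.indicator hW.compl)
  have hae : W.indicator X + Wᶜ.indicator (P⁻[f | 𝓗]) =ᵐ[P] P⁻[f | 𝓗] := by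
    refine ae_eq_condLExp h𝓗 P f hY fun A hA => ?_
    have hAW := hA.inter hW
    have hAW' := hA.inter hW.compl
    have hXm : Measurable[m] (W.indicator X) := hX.mono h𝓗 le_rfl
    simp only [Pi.add_apply]
    rw [lintegral_add_left hXm, setLIntegral_indicator (h𝓗 _ hW),
      setLIntegral_indicator (h𝓗 _ hW.compl), Set.inter_comm W, Set.inter_comm Wᶜ,
      ← h _ hAW Set.inter_subset_right, setLIntegral_condLExp h𝓗 P f hAW',
      ← lintegral_inter_add_sdiff f A (h𝓗 _ hW), Set.sdiff_eq]
  filter_upwards [hae] with ω hω hωW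
  rw [← hω]
  simp [hωW]

end Uniqueness

/-! ### Joint measurability in glued coordinates -/

section JointMeasurability

variable {Ω : Type*} {m : MeasurableSpace Ω} {𝔽 : Filtration ℝ≥0 m} {n : ℕ}

theorem RightMeasurable.measurable_glue {β : Type*} [MeasurableSpace β] {t : ℝ≥0}
    {f : Ω → (Fin n → ℝ≥0) → β} (hf : RightMeasurable 𝔽 t f) (J : Finset (Fin n)) :
    ∀ r > t, Measurable[(prodFiltration 𝔽 ({i // i ∈ J} → ℝ≥0) r).prod MeasurableSpace.pi]
      fun q : (Ω × ({i // i ∈ J} → ℝ≥0)) × ({i // i ∉ J} → ℝ≥0) => f q.1.1 (glue J q.1.2 q.2) := by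
  intro r hr
  let _ : MeasurableSpace Ω := 𝔽 r
  exact (hf r hr).comp (measurable_fst.fst.prodMk
    ((MultiTime.measurable_glue J).comp (measurable_fst.snd.prodMk measurable_snd)))

theorem RightMeasurable.measurable_section [𝔽.IsRightContinuous] {ι β : Type*} [MeasurableSpace β]
    {t : ℝ≥0} {f : Ω → (ι → ℝ≥0) → β} (hf : RightMeasurable 𝔽 t f) (u : ι → ℝ≥0) :
    Measurable[𝔽 t] fun ω => f ω u := by
  have : Measurable[𝔽.rightCont t] fun ω => f ω u := by
    refine measurable_rightCont_iff.2 fun r hr => ?_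
    let _ : MeasurableSpace Ω := 𝔽 r
    exact (hf r hr).comp (measurable_id.prodMk measurable_const)
  rwa [Filtration.IsRightContinuous.eq (𝓕 := 𝔽)] at this

theorem RightMeasurable.measurable {ι β : Type*} [MeasurableSpace β]
    {t : ℝ≥0} {f : Ω → (ι → ℝ≥0) → β} (hf : RightMeasurable 𝔽 t f) :
    Measurable fun p : Ω × (ι → ℝ≥0) => f p.1 p.2 :=
  (hf (t + 1) (lt_add_of_pos_right _ one_pos)).mono
    (sup_le_sup (MeasurableSpace.comap_mono (𝔽.le _)) le_rfl) le_rfl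

theorem IsRegularFamily.isCadlagMartingale {P : Measure Ω} [IsProbabilityMeasure P] {ι : Type*}
    {a : ℝ≥0 → Ω → (ι → ℝ≥0) → ℝ≥0} (ha : IsRegularFamily P 𝔽 a) (x : ι → ℝ≥0) :
    IsCadlagMartingale P 𝔽 fun t ω => a t ω x :=
  ⟨ha.martingale x, fun ω t => ha.right_cont ω x t, fun ω t => ha.left_lim ω x t⟩

end JointMeasurability

/-! ### Bayes' formula for the conditional densities -/

section Enlarged

variable {Ω : Type*} {m : MeasurableSpace Ω} {P : Measure Ω} [IsProbabilityMeasure P]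
  {𝔽 : Filtration ℝ≥0 m} {n : ℕ} {τ : Ω → Fin n → ℝ≥0}
  {μ : Measure ℝ≥0} [SigmaFinite μ] {a : ℝ≥0 → Ω → (Fin n → ℝ≥0) → ℝ≥0}
  {J : Finset (Fin n)} {aJ : ℝ≥0 → Ω → ({i // i ∈ J} → ℝ≥0) → ℝ≥0}

/-- The Bayes formula for the family of conditional densities. -/
theorem setLIntegral_bayes (hτ : Measurable τ) (ha : IsRegularFamily P 𝔽 a)
    (hdens : IsConditionalDensity P 𝔽 μ τ a) (haJ : IsMarginalVersion P 𝔽 μ J a aJ) {T : ℝ≥0}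
    {g : Ω → (Fin n → ℝ≥0) → ℝ≥0∞}
    {b : Ω × ({i // i ∈ J} → ℝ≥0) → (Fin n → ℝ≥0) → ℝ≥0} {bJ : Ω × ({i // i ∈ J} → ℝ≥0) → ℝ≥0}
    {E : Set (Ω × ({i // i ∈ J} → ℝ≥0))}
    (hb : Measurable ({q : (Ω × ({i // i ∈ J} → ℝ≥0)) × ({i // i ∉ J} → ℝ≥0) | q.1 ∈ E}.indicator
      fun q => b q.1 (glue J q.1.2 q.2)))
    {𝓗 : MeasurableSpace (Ω × ({i // i ∈ J} → ℝ≥0))}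
    (h𝓗 : 𝓗 ≤ prodFiltration 𝔽 ({i // i ∈ J} → ℝ≥0) T)
    {𝓢 : ({i // i ∈ J} → ℝ≥0) → MeasurableSpace Ω}
    (hsec : ∀ z, Measurable[𝓢 z, 𝓗] (fun ω => (ω, z)))
    (hE : MeasurableSet[𝓗] E)
    (hgE : Measurable[(prodFiltration 𝔽 ({i // i ∈ J} → ℝ≥0) T).prod MeasurableSpace.pi]
      fun q : (Ω × ({i // i ∈ J} → ℝ≥0)) × ({i // i ∉ J} → ℝ≥0) =>
        E.indicator (fun p => g p.1 (glue J p.2 q.2)) q.1)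
    (hbJ : Measurable[𝓗] (E.indicator bJ))
    (hgsec : ∀ z u, Measurable[𝓢 z] fun ω => E.indicator (fun p => g p.1 u) (ω, z))
    (hOS : ∀ z u (h : Ω → ℝ≥0∞), Measurable[𝓢 z] h → (∀ ω, h ω ≠ 0 → (ω, z) ∈ E) →
      ∫⁻ ω, h ω * (a T ω u : ℝ≥0∞) ∂P = ∫⁻ ω, h ω * (b (ω, z) u : ℝ≥0∞) ∂P)
    (hOSJ : ∀ z (h : Ω → ℝ≥0∞), Measurable[𝓢 z] h → (∀ ω, h ω ≠ 0 → (ω, z) ∈ E) →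
      ∫⁻ ω, h ω * (aJ T ω z : ℝ≥0∞) ∂P = ∫⁻ ω, h ω * (bJ (ω, z) : ℝ≥0∞) ∂P)
    (hX : Measurable[𝓗] (E.indicator fun p => ratio μ J (g p.1) (b p) (fun _ => bJ p) p.2))
    {A : Set Ω} (hA : MeasurableSet A) (hAE : ∀ ω, ω ∈ A ↔ (ω, sub J (τ ω)) ∈ E) :
    ∫⁻ ω in A, g ω (τ ω) ∂P =
      ∫⁻ ω in A, ratio μ J (g ω) (b (ω, sub J (τ ω))) (fun _ => bJ (ω, sub J (τ ω)))
        (sub J (τ ω)) ∂P := by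
  have haT : Measurable fun p : Ω × (Fin n → ℝ≥0) => a T p.1 p.2 := (ha.measurable T).measurable
  have haJT : Measurable[m.prod MeasurableSpace.pi]
      fun p : Ω × ({i // i ∈ J} → ℝ≥0) => aJ T p.1 p.2 :=
    (haJ.regular.measurable T).measurable
  have hglue : Measurable[(m.prod MeasurableSpace.pi).prod MeasurableSpace.pi]
      fun q : (Ω × ({i // i ∈ J} → ℝ≥0)) × ({i // i ∉ J} → ℝ≥0) =>
      (q.1.1, glue J q.1.2 q.2) :=
    measurable_fst.fst.prodMk ((measurable_glue J).comp (measurable_fst.snd.prodMk measurable_snd))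
  have haT' : Measurable[(m.prod MeasurableSpace.pi).prod MeasurableSpace.pi]
      fun q : (Ω × ({i // i ∈ J} → ℝ≥0)) × ({i // i ∉ J} → ℝ≥0) =>
      a T q.1.1 (glue J q.1.2 q.2) := haT.comp hglue
  have hmarg : ∀ᵐ p ∂(P.prod (Measure.pi fun _ : {i // i ∈ J} => μ)), (aJ T p.1 p.2 : ℝ≥0∞) =
      ∫⁻ y, (a T p.1 (glue J p.2 y) : ℝ≥0∞) ∂(Measure.pi fun _ : {i // i ∉ J} => μ) := by
    have hm : MeasurableSet[m.prod MeasurableSpace.pi] {p : Ω × ({i // i ∈ J} → ℝ≥0) |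
        (aJ T p.1 p.2 : ℝ≥0∞) =
        ∫⁻ y, (a T p.1 (glue J p.2 y) : ℝ≥0∞) ∂(Measure.pi fun _ : {i // i ∉ J} => μ)} :=
      measurableSet_eq_fun haJT.coe_nnreal_ennreal
        (@Measurable.lintegral_prod_right' _ _ (m.prod MeasurableSpace.pi) MeasurableSpace.pi _ _
          (f := fun q : (Ω × ({i // i ∈ J} → ℝ≥0)) ×
          ({i // i ∉ J} → ℝ≥0) => (a T q.1.1 (glue J q.1.2 q.2) : ℝ≥0∞)) haT'.coe_nnreal_ennreal)
    exact (Measure.ae_prod_iff_ae_ae hm).2 (haJ.ae_eq T)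
  have key := lintegral_indicator_bayes (P := P) (ν := Measure.pi fun _ : {i // i ∈ J} => μ)
    (κ := Measure.pi fun _ : {i // i ∉ J} => μ) (ξ := fun ω => sub J (τ ω))
    (η := fun ω (i : {i // i ∉ J}) => τ ω i)
    (aT := fun q => a T q.1.1 (glue J q.1.2 q.2)) (b := fun q => b q.1 (glue J q.1.2 q.2))
    (aJT := fun p => aJ T p.1 p.2) (bJ := bJ) (g := fun q => g q.1.1 (glue J q.1.2 q.2))
    haT' haJT hmarg hb ((prodFiltration 𝔽 _).le T) h𝓗 hsec hgE ?_ hE hbJ (fun z y => ?_)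
    (fun z y => ?_) hOSJ hX
  · rw [← lintegral_indicator hA, ← lintegral_indicator hA]
    convert key using 1
    · refine lintegral_congr fun ω => ?_
      by_cases hω : ω ∈ A
      · rw [Set.indicator_of_mem hω, Set.indicator_of_mem ((hAE ω).1 hω)]
        exact congrArg _ (glue_sub J (τ ω)).symm
      · rw [Set.indicator_of_notMem hω, Set.indicator_of_notMem (mt (hAE ω).2 hω)]
    · refine lintegral_congr fun ω => ?_
      by_cases hω : ω ∈ A
      · rw [Set.indicator_of_mem hω, Set.indicator_of_mem ((hAE ω).1 hω)]
        rfl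
      · rw [Set.indicator_of_notMem hω, Set.indicator_of_notMem (mt (hAE ω).2 hω)]
  · intro f hf
    have hle := (prodFiltration 𝔽 ({i // i ∈ J} → ℝ≥0)).le T
    have hfm : Measurable[(m.prod MeasurableSpace.pi).prod MeasurableSpace.pi] f :=
      hf.mono (sup_le_sup (MeasurableSpace.comap_mono hle) le_rfl) le_rfl
    have hf' : Measurable[(𝔽 T).prod MeasurableSpace.pi] fun p : Ω × (Fin n → ℝ≥0) =>
        f ((p.1, sub J p.2), fun i => p.2 i) := by
      let _ : MeasurableSpace Ω := 𝔽 T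
      exact hf.comp ((measurable_fst.prodMk (measurable_sub J measurable_snd)).prodMk
        (measurable_pi_lambda _ fun i => (measurable_pi_apply _).comp measurable_snd))
    have h1 := hdens.lintegral_eq hτ haT hf'
    refine h1.trans ?_
    rw [lintegral_prod _ (@Measurable.lintegral_prod_right' _ _ (m.prod MeasurableSpace.pi)
      MeasurableSpace.pi _ _ (f := fun q :
      (Ω × ({i // i ∈ J} → ℝ≥0)) × ({i // i ∉ J} → ℝ≥0) =>
        f q * (a T q.1.1 (glue J q.1.2 q.2) : ℝ≥0∞))
        (hfm.mul haT'.coe_nnreal_ennreal)).aemeasurable]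
    refine lintegral_congr fun ω => ?_
    have h2 : Measurable fun u : Fin n → ℝ≥0 =>
        f ((ω, sub J u), fun i => u i) * (a T ω u : ℝ≥0∞) := by
      refine Measurable.mul ?_ (haT.comp measurable_prodMk_left).coe_nnreal_ennreal
      exact hfm.comp ((measurable_const.prodMk (measurable_sub J measurable_id)).prodMk
        (measurable_pi_lambda _ fun i => measurable_pi_apply _))
    rw [lintegral_pi_eq_glue J h2]
    simp only [sub_glue, compl_glue]
  · exact hgsec z (glue J z y)
  · exact hOS z (glue J z y)

end Enlarged

/-! ### Variables known after time `t` -/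

section StoppingTimes

variable {X β : Type*} {mX : MeasurableSpace X} [MeasurableSpace β] [Zero β]
  {Q : Filtration ℝ≥0 mX} {S : X → ℝ≥0}

theorem measurable_indicator_le_stoppingTime
    (hS : IsStoppingTime Q fun x => (S x : WithTop ℝ≥0)) {t : ℝ≥0} {f : X → β}
    (hf : Measurable[Q t] f) : Measurable[hS.measurableSpace] ({x | t ≤ S x}.indicator f) := by
  refine measurable_of_indicator_le hS fun s => ?_
  rw [Set.indicator_indicator]
  rcases lt_or_ge s t with hst | hst
  · have : {x | S x ≤ s} ∩ {x | t ≤ S x} = ∅ := by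
      ext x
      simp only [Set.mem_inter_iff, Set.mem_ofPred_eq, Set.mem_empty_iff_false, iff_false, not_and,
        not_le]
      exact fun h => h.trans_lt hst
    rw [this, Set.indicator_empty]
    exact measurable_const
  · refine (hf.mono (Q.mono hst) le_rfl).indicator (MeasurableSet.inter ?_ ?_)
    · simpa only [WithTop.coe_le_coe] using hS s
    · have := (Q.mono hst _ (hS.measurableSet_lt t)).compl
      convert this using 1
      ext x
      simp only [Set.mem_compl_iff, Set.mem_ofPred_eq, WithTop.coe_lt_coe, not_lt]

theorem measurable_coe_stoppingTime [Q.IsRightContinuous]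
    (hS : IsStoppingTime Q fun x => (S x : WithTop ℝ≥0)) : Measurable[hS.measurableSpace] S :=
  measurable_stopped_of_rightContinuous (f := fun s _ => s) (fun _ => measurable_const)
    (fun _ _ => continuousWithinAt_id) hS

theorem measurable_indicator_lt_strictPast {t : ℝ≥0} {f : X → β} (hf : Measurable[Q t] f)
    (S : X → ℝ≥0) : Measurable[strictPast Q S] ({x | t < S x ∨ t = 0}.indicator f) := by
  have hSm : Measurable[strictPast Q S] S :=
    (measurable_predictable_fst Q).comp (comap_measurable _)
  refine @measurable_indicator_of_inter _ _ (strictPast Q S) _ _ _ ?_ _ fun B hB => ?_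
  · exact (hSm measurableSet_Ioi).union (@MeasurableSet.const _ (strictPast Q S) _)
  · have h1 : MeasurableSet[strictPast Q S] ({x | t < S x} ∩ f ⁻¹' B) :=
      ⟨_, measurableSet_predictable_Ioi_prod (hf hB), rfl⟩
    by_cases ht : t = 0
    · subst ht
      have h2 : MeasurableSet[strictPast Q S] ({x | S x = 0} ∩ f ⁻¹' B) :=
        ⟨_, measurableSet_predictable_singleton_bot_prod (hf hB), rfl⟩
      convert h2.union h1 using 1
      ext x
      rcases eq_or_ne (S x) 0 with h | h <;> simp [h, pos_iff_ne_zero]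
    · simpa [ht] using h1

end StoppingTimes

/-! ### Part (i): stopping times of the enlargement -/

section Enlarged

variable {Ω : Type*} {m : MeasurableSpace Ω} {P : Measure Ω} [IsProbabilityMeasure P]
  {𝔽 : Filtration ℝ≥0 m} {n : ℕ} {τ : Ω → Fin n → ℝ≥0}
  {μ : Measure ℝ≥0} [SigmaFinite μ] {a : ℝ≥0 → Ω → (Fin n → ℝ≥0) → ℝ≥0}
  {J : Finset (Fin n)} {aJ : ℝ≥0 → Ω → ({i // i ∈ J} → ℝ≥0) → ℝ≥0}

/-- The time `t` may exceed the bound on `U`; then `E` is empty, which is why `t < T` is asked only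
for nonempty `E`. -/
theorem RightMeasurable.measurable_indicator_glue {t T : ℝ≥0} {g : Ω → (Fin n → ℝ≥0) → ℝ≥0∞}
    (hg : RightMeasurable 𝔽 t g) {E : Set (Ω × ({i // i ∈ J} → ℝ≥0))}
    (hE : MeasurableSet[prodFiltration 𝔽 ({i // i ∈ J} → ℝ≥0) T] E) (hT : E.Nonempty → t < T) :
    Measurable[(prodFiltration 𝔽 ({i // i ∈ J} → ℝ≥0) T).prod MeasurableSpace.pi]
      fun q : (Ω × ({i // i ∈ J} → ℝ≥0)) × ({i // i ∉ J} → ℝ≥0) =>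
        E.indicator (fun p => g p.1 (glue J p.2 q.2)) q.1 := by
  rcases E.eq_empty_or_nonempty with rfl | hne
  · simp only [Set.indicator_empty]
    exact measurable_const
  · exact (hg.measurable_glue J T (hT hne)).indicator
      ((@measurable_fst _ _ (prodFiltration 𝔽 ({i // i ∈ J} → ℝ≥0) T) _) hE)

theorem measurable_initialEnlargement_section (hτ : Measurable τ) (t : ℝ≥0) :
    Measurable[initialEnlargement 𝔽 (fun ω => sub J (τ ω)) (measurable_sub J hτ) t,
      (prodFiltration 𝔽 ({i // i ∈ J} → ℝ≥0)).rightCont t] fun ω => (ω, sub J (τ ω)) := by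
  rw [measurable_iff_comap_le]
  exact (initialEnlargement_eq_comap 𝔽 _ _ t).ge

theorem condLExp_initialEnlargement_stoppingTime [𝔽.IsRightContinuous] (hτ : Measurable τ)
    (ha : IsRegularFamily P 𝔽 a) (hdens : IsConditionalDensity P 𝔽 μ τ a)
    (haJ : IsMarginalVersion P 𝔽 μ J a aJ) {t : ℝ≥0} {g : Ω → (Fin n → ℝ≥0) → ℝ≥0∞}
    (hg : RightMeasurable 𝔽 t g) {U : Ω → ℝ≥0} {C : ℝ≥0} (hUb : ∀ ω, U ω ≤ C)
    (hU : IsStoppingTime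
      (initialEnlargement 𝔽 (fun ω => sub J (τ ω)) (measurable_sub J hτ))
      (fun ω => (U ω : WithTop ℝ≥0))) :
    ∀ᵐ ω ∂P, t ≤ U ω →
      (P⁻[fun ω' => g ω' (τ ω') | hU.measurableSpace]) ω =
        ratio μ J (g ω) (a (U ω) ω) (aJ (U ω) ω) (sub J (τ ω)) := by
  have hQ := initialEnlargement_eq_comap 𝔽 (fun ω => sub J (τ ω)) (measurable_sub J hτ)
  obtain ⟨S, hS, hSC, hSU⟩ := exists_stoppingTime_lift hQ hU hUb
  have hφ := measurable_initialEnlargement_section (𝔽 := 𝔽) (J := J) hτ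
  have hle := measurableSpace_le_comap hQ hU hUb hS hSU
  obtain rfl : U = fun ω => S (ω, sub J (τ ω)) := funext fun ω => (hSU ω).symm
  have hST : hS.measurableSpace ≤ prodFiltration 𝔽 ({i // i ∈ J} → ℝ≥0) (C + 1) :=
    (measurableSpace_le_of_bounded hS hSC).trans
      (rightCont_le_of_lt _ (lt_add_of_pos_right C one_pos))
  have hSm := measurable_coe_stoppingTime hS
  have htS : MeasurableSet[hS.measurableSpace] {p | t ≤ S p} := hSm measurableSet_Ici
  have hpull : Measurable[hU.measurableSpace, hS.measurableSpace] fun ω => (ω, sub J (τ ω)) :=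
    measurable_stoppingTime_comp hφ hS
  have hX := measurable_ratio_stopped (Measure.pi fun _ : {i // i ∉ J} => μ)
    (α := fun s q => a s q.1.1 (glue J q.1.2 q.2)) (β := fun s p => aJ s p.1 p.2)
    (γ := fun q => g q.1.1 (glue J q.1.2 q.2)) (fun s => (ha.measurable s).measurable_glue J)
    (fun q s => ha.right_cont _ _ s) (fun s r hr => haJ.regular.measurable s r hr)
    (fun p s => haJ.regular.right_cont _ _ s) (hg.measurable_glue J) hS
  have hGm : hU.measurableSpace ≤ m := hU.measurableSpace_le
  refine condLExp_ae_eq_of_setLIntegral_eq_on hGm (W := {ω | t ≤ S (ω, sub J (τ ω))})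
    (hpull htS) (hX.comp hpull) fun A hA hAW => ?_
  obtain ⟨A', hA', rfl⟩ := hle A hA
  have hE := hA'.inter htS
  set E := A' ∩ {p | t ≤ S p} with hEdef
  have hsec := fun z => measurable_stoppingTime_comp
    (measurable_section 𝔽 (Z := {i // i ∈ J} → ℝ≥0) z) hS
  have hSm' : Measurable S := hSm.mono (hST.trans ((prodFiltration 𝔽 _).le _)) le_rfl
  have hEm : MeasurableSet E := (hST.trans ((prodFiltration 𝔽 _).le _)) _ hE
  refine setLIntegral_bayes hτ ha hdens haJ (T := C + 1) (E := E)
    (b := fun p u => a (S p) p.1 u) (bJ := fun p => aJ (S p) p.1 p.2) ?_ hST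
    (𝓢 := fun z => (isStoppingTime_comp (measurable_section 𝔽 z) hS).measurableSpace) hsec hE
    ?_ ?_ ?_ ?_ ?_ ?_ (hGm _ hA) fun ω => ⟨fun h => ⟨h, hAW h⟩, fun h => h.1⟩
  · refine Measurable.indicator ?_ (measurable_fst hEm)
    have h1 := measurable_min_const_of_rightContinuous
      (X := (Ω × ({i // i ∈ J} → ℝ≥0)) × ({i // i ∉ J} → ℝ≥0))
      (f := fun s q => a s q.1.1 (glue J q.1.2 q.2)) (lt_add_of_pos_right C one_pos)
      (fun s _ => ((ha.measurable s).measurable_glue J (s + 1) (lt_add_of_pos_right s one_pos)).mono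
        (sup_le_sup (MeasurableSpace.comap_mono ((prodFiltration 𝔽 _).le _)) le_rfl) le_rfl)
      (fun q s => ha.right_cont _ _ s)
    have h2 := h1.comp ((hSm'.comp measurable_fst).prodMk measurable_id)
    convert h2 using 2 with q
    simp [min_eq_left (hSC _)]
  · exact hg.measurable_indicator_glue (hST _ hE) fun ⟨p, hp⟩ =>
      (hp.2.trans (hSC p)).trans_lt (lt_add_of_pos_right C one_pos)
  · exact (measurable_stopped_of_rightContinuous (f := fun s p => aJ s p.1 p.2)
      (fun s => measurable_rightCont_iff.2 fun r hr => haJ.regular.measurable s r hr)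
      (fun p s => haJ.regular.right_cont _ _ s) hS).indicator hE
  · intro z u
    -- With `z` frozen, `g` is known at time `t`, hence known at `S(·, z)` on `{t ≤ S(·, z)}`.
    simp only [hEdef, ← Set.indicator_indicator]
    exact (measurable_indicator_le_stoppingTime (isStoppingTime_comp (measurable_section 𝔽 z) hS)
      (hg.measurable_section u)).indicator (hsec z hA')
  · intro z u h hh _
    exact (ha.isCadlagMartingale u).lintegral_mul_stopped _ (fun ω => hSC _) hh
  · intro z h hh _
    exact (haJ.regular.isCadlagMartingale z).lintegral_mul_stopped _ (fun ω => hSC _) hh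
  · rw [hEdef, ← Set.indicator_indicator]
    exact hX.indicator hA'

end Enlarged

/-! ### Announcing sequences and their lifts -/

section Announcing

variable {X X' : Type*} {mX : MeasurableSpace X} {mX' : MeasurableSpace X'}
  {Q : Filtration ℝ≥0 mX} {Q' : Filtration ℝ≥0 mX'} {φ : X → X'}

/-- If all null sets belong to `Q 0`, a predictable time is announced everywhere. -/
theorem IsPredictableTime.exists_announcing {P : Measure X}
    (hnull : ∀ s : Set X, P s = 0 → MeasurableSet[Q 0] s) {U : X → ℝ≥0}
    (hU : IsPredictableTime P Q U) :
    ∃ V : ℕ → X → ℝ≥0, (∀ j, IsStoppingTime Q fun x => (V j x : WithTop ℝ≥0)) ∧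
      ∀ x, Monotone (fun j => V j x) ∧ (0 < U x → ∀ j, V j x < U x) ∧
        Tendsto (fun j => V j x) atTop (𝓝 (U x)) := by
  classical
  obtain ⟨-, V, hV, hae⟩ := hU
  set N : Set X := {x | ¬ (Monotone (fun j => V j x) ∧ (0 < U x → ∀ j, V j x < U x) ∧
      Tendsto (fun j => V j x) atTop (𝓝 (U x)))} with hN
  have hN0 : P N = 0 := hae
  have hsub : ∀ s, ∀ D ⊆ N, MeasurableSet[Q s] D := fun s D hD =>
    Q.mono (zero_le) _ (hnull D (measure_mono_null hD hN0))
  -- On the exceptional null set the sequence is replaced by `c j * U` with `c j` increasing to `1`.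
  -- Every subset of a null set belongs to `Q 0`, so this does not affect the stopping time
  -- property.
  let c : ℕ → ℝ≥0 := fun j => 1 - 1 / ((j : ℝ≥0) + 1)
  have hc1 : ∀ j, c j < 1 := fun j => tsub_lt_self one_pos (by positivity)
  have hcm : Monotone c := fun i j hij =>
    tsub_le_tsub_left (one_div_le_one_div_of_le (by positivity) (by gcongr)) _
  have hct : Tendsto c atTop (𝓝 1) := by
    have h := (tendsto_const_nhds (x := (1 : ℝ≥0))).sub
      (tendsto_one_div_add_atTop_nhds_zero_nat (𝕜 := ℝ≥0))
    simpa [c] using h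
  refine ⟨fun j x => if x ∈ N then c j * U x else V j x, fun j s => ?_, fun x => ?_⟩
  · have : {x | ((if x ∈ N then c j * U x else V j x : ℝ≥0) : WithTop ℝ≥0) ≤ s} =
        (N ∩ {x | c j * U x ≤ s}) ∪ (Nᶜ ∩ {x | (V j x : WithTop ℝ≥0) ≤ s}) := by
      ext x
      by_cases hx : x ∈ N <;>
        simp only [hx, if_true, if_false, WithTop.coe_le_coe, Set.mem_ofPred_eq, Set.mem_union,
          Set.mem_inter_iff, Set.mem_compl_iff, not_true, not_false_iff, true_and, false_and,
          or_false, false_or]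
    rw [this]
    exact (hsub s _ Set.inter_subset_left).union ((hsub s _ le_rfl).compl.inter (hV j s))
  · by_cases hx : x ∈ N
    · simp only [hx, if_true]
      refine ⟨fun i j hij => mul_le_mul_left (hcm hij) _, fun h j => ?_, ?_⟩
      · exact mul_lt_of_lt_one_left h (hc1 j)
      · simpa using hct.mul_const (U x)
    · simp only [hx, if_false]
      exact not_not.1 hx

theorem exists_announcing_lift (hQ : ∀ t, Q t = (Q' t).comap φ) [Q'.IsRightContinuous]
    {U : X → ℝ≥0} {C : ℝ≥0} (hC : ∀ x, U x ≤ C) {V : ℕ → X → ℝ≥0}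
    (hV : ∀ j, IsStoppingTime Q fun x => (V j x : WithTop ℝ≥0))
    (hmono : ∀ x, Monotone fun j => V j x)
    (hlim : ∀ x, Tendsto (fun j => V j x) atTop (𝓝 (U x))) :
    ∃ (W : ℕ → X' → ℝ≥0) (S : X' → ℝ≥0),
      (∀ j, IsStoppingTime Q' fun x => (W j x : WithTop ℝ≥0)) ∧ (∀ x, Monotone fun j => W j x) ∧
      (∀ j x, W j x ≤ C) ∧ (∀ x, S x ≤ C) ∧ (∀ x, Tendsto (fun j => W j x) atTop (𝓝 (S x))) ∧
      (∀ j x, W j (φ x) = V j x) ∧ ∀ x, S (φ x) = U x := by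
  have hVC : ∀ j x, V j x ≤ C := fun j x => ((hmono x).ge_of_tendsto (hlim x) j).trans (hC x)
  choose L hL hLC hLV using fun j => exists_stoppingTime_lift hQ (hV j) (hVC j)
  -- Separately lifted times need not be monotone off the image of `φ`; partial suprema restore this
  -- and change nothing on the image. Strict announcement is not restored.
  let W : ℕ → X' → ℝ≥0 := fun j x => partialSups (fun i => L i x) j
  have hWC : ∀ j x, W j x ≤ C := fun j x => partialSups_le _ _ _ fun i _ => hLC i x
  have hWm : ∀ x, Monotone fun j => W j x := fun x => (partialSups fun i => L i x).monotone
  have hWV : ∀ j x, W j (φ x) = V j x := fun j x => by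
    simp only [W, hLV]
    rw [(hmono x).partialSups_eq]
  have hbdd : ∀ x, BddAbove (Set.range fun j => W j x) := fun x =>
    ⟨C, by rintro _ ⟨j, rfl⟩; exact hWC j x⟩
  have hWt : ∀ x, Tendsto (fun j => W j x) atTop (𝓝 (⨆ j, W j x)) := fun x =>
    tendsto_atTop_ciSup (hWm x) (hbdd x)
  refine ⟨W, fun x => ⨆ j, W j x, fun j s => ?_, hWm, hWC, fun x => ciSup_le fun j => hWC j x, hWt,
    hWV, fun x => ?_⟩
  · have : {x | (W j x : WithTop ℝ≥0) ≤ s} = ⋂ i ∈ Set.Iic j, {x | (L i x : WithTop ℝ≥0) ≤ s} := by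
      ext x
      simp only [W, WithTop.coe_le_coe, Set.mem_ofPred_eq, Set.mem_iInter, Set.mem_Iic,
        partialSups_le_iff]
    rw [this]
    exact MeasurableSet.biInter (Set.to_countable _) fun i _ => hL i s
  · refine tendsto_nhds_unique (hWt (φ x)) ?_
    simpa only [hWV] using hlim x

theorem measurable_strictPast_comp (hφ : ∀ t, Measurable[Q t, Q' t] φ) (S : X' → ℝ≥0) :
    Measurable[strictPast Q (fun x => S (φ x)), strictPast Q' S] φ := by
  rintro _ ⟨B, hB, rfl⟩
  exact ⟨_, measurable_predictable_map hφ hB, rfl⟩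

theorem strictPast_le (S : X → ℝ≥0) (hS : Measurable S) : strictPast Q S ≤ mX := by
  rw [strictPast, MeasurableSpace.comap_le_iff_le_map]
  refine measurableSpace_le_predictable_of_measurableSet ?_ ?_
  · intro A hA
    exact (hS.prodMk measurable_id) ((measurableSet_singleton _).prod (Q.le _ _ hA))
  · intro i A hA
    exact (hS.prodMk measurable_id) (measurableSet_Ioi.prod (Q.le _ _ hA))

end Announcing

/-! ### Part (ii): predictable times of the enlargement -/

section Enlarged

variable {Ω : Type*} {m : MeasurableSpace Ω} {P : Measure Ω}
  {𝔽 : Filtration ℝ≥0 m} {n : ℕ} {τ : Ω → Fin n → ℝ≥0}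
  {μ : Measure ℝ≥0} {a : ℝ≥0 → Ω → (Fin n → ℝ≥0) → ℝ≥0}
  {J : Finset (Fin n)} {aJ : ℝ≥0 → Ω → ({i // i ∈ J} → ℝ≥0) → ℝ≥0}

theorem measurable_leftVal_glue (ha : IsRegularFamily P 𝔽 a)
    {S : Ω × ({i // i ∈ J} → ℝ≥0) → ℝ≥0} (hS : Measurable S) :
    Measurable fun q : (Ω × ({i // i ∈ J} → ℝ≥0)) × ({i // i ∉ J} → ℝ≥0) =>
      leftVal a (S q.1) q.1.1 (glue J q.1.2 q.2) := by
  have hm := measurable_leftLim (Q := prodFiltration 𝔽 ({i // i ∈ J} → ℝ≥0))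
    (α := fun s (q : (Ω × ({i // i ∈ J} → ℝ≥0)) × ({i // i ∉ J} → ℝ≥0)) =>
      a s q.1.1 (glue J q.1.2 q.2)) (fun s => (ha.measurable s).measurable_glue J)
    (fun q s => ha.left_lim _ _ s)
  have hid : Measurable[_, (prodFiltration 𝔽 ({i // i ∈ J} → ℝ≥0)).predictable]
      fun p : Ω × ({i // i ∈ J} → ℝ≥0) => (S p, p) :=
    measurable_iff_comap_le.2 (strictPast_le S hS)
  have h1 := hm.comp ((hid.comp measurable_fst).prodMk measurable_snd :
    @Measurable ((Ω × ({i // i ∈ J} → ℝ≥0)) × ({i // i ∉ J} → ℝ≥0)) _ _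
      ((prodFiltration 𝔽 ({i // i ∈ J} → ℝ≥0)).predictable.prod MeasurableSpace.pi)
      fun q => ((S q.1, q.1), q.2))
  have h2 : Measurable fun q : (Ω × ({i // i ∈ J} → ℝ≥0)) × ({i // i ∉ J} → ℝ≥0) =>
      a 0 q.1.1 (glue J q.1.2 q.2) := (ha.measurable 0).measurable.comp
    (measurable_fst.fst.prodMk ((measurable_glue J).comp (measurable_fst.snd.prodMk measurable_snd)))
  have h3 : MeasurableSet {q : (Ω × ({i // i ∈ J} → ℝ≥0)) × ({i // i ∉ J} → ℝ≥0) | S q.1 = 0} :=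
    (hS.comp measurable_fst) (measurableSet_singleton 0)
  convert h1.add (h2.indicator h3) using 1
  ext q
  rcases eq_or_ne (S q.1) 0 with h | h
  · simp [h, leftVal_zero]
  · simp [h, pos_iff_ne_zero, leftVal]

theorem condLExp_initialEnlargement_strictPast [IsProbabilityMeasure P]
    [SigmaFinite μ] (h𝔽 : UsualConditions P 𝔽) (hτ : Measurable τ)
    (ha : IsRegularFamily P 𝔽 a) (hdens : IsConditionalDensity P 𝔽 μ τ a)
    (haJ : IsMarginalVersion P 𝔽 μ J a aJ) {t : ℝ≥0} {g : Ω → (Fin n → ℝ≥0) → ℝ≥0∞}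
    (hg : RightMeasurable 𝔽 t g) {U : Ω → ℝ≥0} {C : ℝ≥0} (hUb : ∀ ω, U ω ≤ C)
    (hU : IsPredictableTime P
      (initialEnlargement 𝔽 (fun ω => sub J (τ ω)) (measurable_sub J hτ)) U) :
    ∀ᵐ ω ∂P, (t < U ω ∨ t = 0) →
      (P⁻[fun ω' => g ω' (τ ω') | strictPast
          (initialEnlargement 𝔽 (fun ω => sub J (τ ω)) (measurable_sub J hτ)) U]) ω =
        ratio μ J (g ω) (leftVal a (U ω) ω) (leftVal aJ (U ω) ω) (sub J (τ ω)) := by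
  have _ : 𝔽.IsRightContinuous := h𝔽.1
  have hQ := initialEnlargement_eq_comap 𝔽 (fun ω => sub J (τ ω)) (measurable_sub J hτ)
  have hφ := measurable_initialEnlargement_section (𝔽 := 𝔽) (J := J) hτ
  obtain ⟨V', hV', hann⟩ := hU.exists_announcing fun s hs => by
    refine (?_ : 𝔽 0 ≤ _) _ (h𝔽.2 s hs)
    exact le_iInf₂ fun r hr => (𝔽.mono hr.le).trans le_sup_left
  obtain ⟨V, S, hV, hVm, hVC, hSC, hVS, hVV, hSU⟩ := exists_announcing_lift hQ hUb hV'
    (fun x => (hann x).1) fun x => (hann x).2.2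
  obtain rfl : U = fun ω => S (ω, sub J (τ ω)) := funext fun ω => (hSU ω).symm
  obtain rfl : V' = fun j ω => V j (ω, sub J (τ ω)) := funext₂ fun j ω => (hVV j ω).symm
  set 𝓗 := ⨆ j, (hV j).measurableSpace with h𝓗
  have hlub : ∀ p, IsLUB (Set.range fun j => V j p) (S p) := fun p =>
    isLUB_of_tendsto_atTop (hVm p) (hVS p)
  have hpast : strictPast (prodFiltration 𝔽 ({i // i ∈ J} → ℝ≥0)).rightCont S ≤ 𝓗 :=
    strictPast_le_iSup hV hlub
  have h𝓗T : 𝓗 ≤ prodFiltration 𝔽 ({i // i ∈ J} → ℝ≥0) (C + 1) :=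
    iSup_le fun j => (measurableSpace_le_of_bounded (hV j) (hVC j)).trans
      (rightCont_le_of_lt _ (lt_add_of_pos_right C one_pos))
  have hSp : Measurable[strictPast (prodFiltration 𝔽 ({i // i ∈ J} → ℝ≥0)).rightCont S] S :=
    (measurable_predictable_fst _).comp (comap_measurable _)
  have htS : MeasurableSet[strictPast (prodFiltration 𝔽 ({i // i ∈ J} → ℝ≥0)).rightCont S]
      {p | t < S p ∨ t = 0} :=
    (hSp measurableSet_Ioi).union (@MeasurableSet.const _ (strictPast _ S) _)
  have hpull := measurable_strictPast_comp hφ S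
  have hX := (measurable_ratio_leftLim (t := t) (Measure.pi fun _ : {i // i ∉ J} => μ)
    (α := fun s q => a s q.1.1 (glue J q.1.2 q.2)) (β := fun s p => aJ s p.1 p.2)
    (γ := fun q => g q.1.1 (glue J q.1.2 q.2)) (fun s => (ha.measurable s).measurable_glue J)
    (fun q s => ha.left_lim _ _ s) (fun s r hr => haJ.regular.measurable s r hr)
    (fun p s => haJ.regular.left_lim _ _ s) (hg.measurable_glue J)).comp
      (comap_measurable fun p => (S p, p))
  have hSm : Measurable[m.prod MeasurableSpace.pi] S :=
    hSp.mono (hpast.trans (h𝓗T.trans ((prodFiltration 𝔽 _).le _))) le_rfl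
  have hGm := strictPast_le (Q := initialEnlargement 𝔽 (fun ω => sub J (τ ω)) (measurable_sub J hτ))
    (fun ω => S (ω, sub J (τ ω))) (hSm.comp (measurable_id.prodMk (measurable_sub J hτ)))
  refine condLExp_ae_eq_of_setLIntegral_eq_on hGm
    (W := {ω | t < S (ω, sub J (τ ω)) ∨ t = 0}) (hpull htS) (hX.comp hpull) fun A hA hAW => ?_
  obtain ⟨A', hA', rfl⟩ := strictPast_le_comap hQ S A hA
  -- The lifted sequence is known to announce `S` strictly only on the graph of `τ_J`. Intersecting
  -- with this event, which contains the graph, supplies what optional sampling needs at every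
  -- frozen `z` without changing `A`.
  have hB : MeasurableSet[𝓗] {p | S p = 0 ∨ ∀ j, V j p < S p} := by
    have h1 := hSp.mono hpast le_rfl
    simp only [Set.ofPred_or, Set.ofPred_forall]
    refine (h1 (measurableSet_singleton 0)).union (MeasurableSet.iInter fun j => ?_)
    exact measurableSet_lt
      ((measurable_coe_stoppingTime (hV j)).mono (le_iSup (fun j => (hV j).measurableSpace) j)
        le_rfl) h1
  have hAB := (hpast _ hA').inter hB
  have hE := hAB.inter (hpast _ htS)
  set E := A' ∩ {p | S p = 0 ∨ ∀ j, V j p < S p} ∩ {p | t < S p ∨ t = 0} with hEdef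
  have hsec : ∀ z : {i // i ∈ J} → ℝ≥0,
      Measurable[⨆ j, (isStoppingTime_comp (measurable_section 𝔽 z) (hV j)).measurableSpace, 𝓗]
        fun ω => (ω, z) := fun z => by
    rw [measurable_iff_comap_le, h𝓗, MeasurableSpace.comap_iSup]
    exact iSup_mono fun j => (measurable_stoppingTime_comp (measurable_section 𝔽 z) (hV j)).comap_le
  have hEm : MeasurableSet[m.prod MeasurableSpace.pi] E :=
    (h𝓗T.trans ((prodFiltration 𝔽 _).le _)) _ hE
  refine setLIntegral_bayes hτ ha hdens haJ (T := C + 1) (E := E)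
    (b := fun p u => leftVal a (S p) p.1 u) (bJ := fun p => leftVal aJ (S p) p.1 p.2) ?_ h𝓗T
    hsec hE ?_ ?_ ?_ ?_ ?_ ?_ (hGm _ hA) fun ω => ⟨fun h => ⟨⟨h, ?_⟩, hAW h⟩, fun h => h.1.1⟩
  · exact (measurable_leftVal_glue ha hSm).indicator (measurable_fst hEm)
  · refine hg.measurable_indicator_glue (h𝓗T _ hE) fun ⟨p, hp⟩ => ?_
    rcases hp.2 with h | h
    · exact (h.trans_le (hSC p)).trans (lt_add_of_pos_right C one_pos)
    · rw [h]; positivity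
  · refine Measurable.indicator ?_ hE
    exact ((measurable_leftLim_predictable (K := prodFiltration 𝔽 ({i // i ∈ J} → ℝ≥0))
      (β := fun s p => aJ s p.1 p.2) (fun s r hr => haJ.regular.measurable s r hr)
      (fun p s => haJ.regular.left_lim _ _ s)).comp
        (comap_measurable fun p => (S p, p))).mono hpast le_rfl
  · intro z u
    have h := ((measurable_indicator_lt_strictPast (hg.measurable_section u) fun ω => S (ω, z)).mono
      (strictPast_le_iSup (fun j => isStoppingTime_comp (measurable_section 𝔽 z) (hV j))
        fun ω => hlub (ω, z)) le_rfl).indicator (hsec z hAB)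
    rw [Set.indicator_indicator] at h
    exact h
  · intro z u h hh h0
    exact (ha.isCadlagMartingale u).lintegral_mul_leftVal _ (fun ω => hVm (ω, z))
      (fun j ω => hVC j (ω, z)) (fun ω => hVS (ω, z)) hh fun ω hω => (h0 ω hω).1.2
  · intro z h hh h0
    exact (haJ.regular.isCadlagMartingale z).lintegral_mul_leftVal _ (fun ω => hVm (ω, z))
      (fun j ω => hVC j (ω, z)) (fun ω => hVS (ω, z)) hh fun ω hω => (h0 ω hω).1.2
  · rw [hEdef, ← Set.indicator_indicator]
    exact (hX.mono hpast le_rfl).indicator hAB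
  · rcases eq_or_ne (S (ω, sub J (τ ω))) 0 with h0 | h0
    · exact Or.inl h0
    · exact Or.inr ((hann ω).2.1 (pos_iff_ne_zero.2 h0))

end Enlarged

end MultiTime
open MultiTime in
theorem mainTheorem9 {Ω : Type*} {m : MeasurableSpace Ω} (P : Measure Ω) [IsProbabilityMeasure P]
    (𝔽 : Filtration ℝ≥0 m) (h𝔽 : UsualConditions P 𝔽)
    {n k : ℕ} (τ : Ω → Fin n → ℝ≥0) (hτ : Measurable τ)
    (μ : Measure ℝ≥0) [SigmaFinite μ] (hμ : ∀ x, μ {x} = 0)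
    (a : ℝ≥0 → Ω → (Fin n → ℝ≥0) → ℝ≥0)
    (ha : IsRegularFamily P 𝔽 a) (hdens : IsConditionalDensity P 𝔽 μ τ a)
    (ϱ : Fin k ↪ Fin n) (T : Finset (Fin k))
    (aJ : ℝ≥0 → Ω → ({i // i ∈ T.map ϱ} → ℝ≥0) → ℝ≥0)
    (haJ : IsMarginalVersion P 𝔽 μ (T.map ϱ) a aJ)
    (t : ℝ≥0) (g : Ω → (Fin n → ℝ≥0) → ℝ≥0∞) (hg : RightMeasurable 𝔽 t g)
    (U : Ω → ℝ≥0) (hUb : ∃ C : ℝ≥0, ∀ ω, U ω ≤ C)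
    (hU : IsStoppingTime
      (initialEnlargement 𝔽 (fun ω => sub (T.map ϱ) (τ ω)) (measurable_sub (T.map ϱ) hτ))
      (fun ω => (U ω : WithTop ℝ≥0))) :
    (∀ᵐ ω ∂P, t ≤ U ω →
      (P⁻[fun ω' => g ω' (τ ω') | hU.measurableSpace]) ω =
        ratio μ (T.map ϱ) (g ω) (a (U ω) ω) (aJ (U ω) ω) (sub (T.map ϱ) (τ ω))) ∧
    (IsPredictableTime P
        (initialEnlargement 𝔽 (fun ω => sub (T.map ϱ) (τ ω)) (measurable_sub (T.map ϱ) hτ)) U →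
      ∀ᵐ ω ∂P, (t < U ω ∨ t = 0) →
        (P⁻[fun ω' => g ω' (τ ω') | strictPast
            (initialEnlargement 𝔽 (fun ω => sub (T.map ϱ) (τ ω)) (measurable_sub (T.map ϱ) hτ))
            U]) ω =
          ratio μ (T.map ϱ) (g ω) (leftVal a (U ω) ω) (leftVal aJ (U ω) ω)
            (sub (T.map ϱ) (τ ω))) := by
  obtain ⟨C, hC⟩ := hUb
  have _ : 𝔽.IsRightContinuous := h𝔽.1
  exact ⟨condLExp_initialEnlargement_stoppingTime hτ ha hdens haJ hg hC hU,
    condLExp_initialEnlargement_strictPast h𝔽 hτ ha hdens haJ hg hC⟩
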